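/- **Setting.** Graphs are finite, simple and undirected, with vertices labelled by natural numbers. Strings are encoded inputs and outputs of algorithms, natural-number parameters count with their numerical value (unary), and "polynomial time" is polynomial in the total input length. A graph optimization problem $P$ (minimization or maximization) assigns to every graph $G$ and string $s$ a value $P(G,s)\in\mathbb R\cup\{\pm\infty\}$; $s$ is a *solution* for $G$ if the value is not $+\infty$ (minimization), resp. not $-\infty$ (maximization). $\mathrm{OPT}_P(G)$ is the infimum, resp. supremum, of the values. Solutions have length polynomial in the input length, and one can decide in polynomial time in $|G|+|s|+a+b$ whether $P(G,s)\le a/b$, for $a,b\in\mathbb N$, $b>0$. A value $v$ is *within factor $\rho$* of an optimum $o$ if $v\le\rho\, o$ (minimization), resp. $o\le\rho\, v$ (maximization); a solution $s$ for $G$ is *$\rho$-approximate* if $P(G,s)$ is within factor $\rho$ of $\mathrm{OPT}_P(G)$. An *instance* $(G,\mathcal T,\ell)$ is a graph $G$ with a tree decomposition $\mathcal T$ of width at most $\ell\in\mathbb N$. **Friendly problems.** Let $f\colon\mathbb N\to\mathbb R$, $h\colon\mathbb R\times\mathbb N\to\mathbb N$ and $\varphi\colon\mathbb R\times\mathbb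 N\to\mathbb R$. $P$ is *friendly* with respect to $f,h,\varphi$ if: 1. (Unions.) $\mathrm{OPT}_P(\emptyset)=0$ for the empty graph. If $G$ is the disjoint union of $G_1$ and $G_2$, then $\mathrm{OPT}_P(G)=\mathrm{OPT}_P(G_1)+\mathrm{OPT}_P(G_2)$; from solutions $S_1$ for $G_1$ and $S_2$ for $G_2$ one obtains in polynomial time a solution $S$ ("$S_1\cup S_2$") for $G$ with $P(G,S)=P(G_1,S_1)+P(G_2,S_2)$, and from a solution $S$ for $G$ one obtains in polynomial time solutions $S_1$, $S_2$ for $G_1$, $G_2$ with this equality. 2. (Vertex deletion.) $f$ is a non-decreasing polynomial, and $\mathrm{OPT}_P(G-X)\le\mathrm{OPT}_P(G)\le\mathrm{OPT}_P(G-X)+f(|X|)$ for every graph $G$ and $X\subseteq V(G)$. For minimization, a polynomial-time algorithm turns $G$, $X$ and a solution $S'$ for $G-X$ into a solution $S$ for $G$ with $P(G,S)\le P(G-X,S')+f(|X|)$. For maximization, every solution $S$ for $G-X$ is also a solution for $G$, and $P(G,S)=P(G-X,S)$. 3. (Kernels.) Let $P^\bot(G,m,s)=\min\{P(G,s),m+1\}$,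 where the parameter $m$ is the sum $k+\ell$ of the solution value and the width. For every $\delta>0$, $h(\delta,\cdot)$ is non-decreasing and polynomially bounded, and $P^\bot$ has a $(1+\delta)$-approximate kernel with $h(\delta,m)$ vertices. That is: a polynomial-time reduction algorithm maps every instance $(G,\mathcal T,m)$ to a graph $G'$ with at most $h(\delta,m)$ vertices and a number $m'$, where $m'$ and the length of the encoding of $G'$ are bounded by a polynomial in $m$; and a polynomial-time lifting algorithm, given the instance, $(G',m')$ and a solution $s'$ for $G'$, returns a string $s$ such that, for every $\rho\ge1$, if $P^\bot(G',m',s')$ is within factor $\rho$ of $\mathrm{OPT}_{P^\bot}(G',m')$, then $P^\bot(G,m,s)$ is within factor $(1+\delta)\rho$ of $\mathrm{OPT}_{P^\bot}(G,m)$. 4. (Approximation.) $\varphi$ is a polynomial in its two arguments, non-decreasing in the first, with $\alpha\,\varphi(k,\ell)\le\varphi(\alpha k,\ell)$ for all $\alpha>1$, $k\ge0$, $\ell\in\mathbb N$; and a polynomial-time algorithm returns for every instance $(G,\mathcal T,\ell)$ a solution $S$ for $G$ with $P(G,S)\le\varphi(\mathrm{OPT}_P(G),\ell)$ (minimization), resp.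 $\mathrm{OPT}_P(G)\le\varphi(P(G,S),\ell)$ (maximization). **Theorem.** Let $P$ be a graph optimization problem, minimization or maximization, that is friendly with respect to $f,h,\varphi$, and let $0<\varepsilon\le1$. Then $P$, parameterized by treewidth $\ell$ (with a tree decomposition given), has a $(1+\varepsilon)$-approximate Turing kernel with $$N(\ell)=h\Bigl(\tfrac{\varepsilon}{3},\ \Bigl\lfloor\varphi\Bigl(\tfrac{6f(\ell+1)}{\varepsilon}+f(1),\,\ell\Bigr)\Bigr\rfloor+\ell\Bigr)$$ vertices. That is, there are an oracle algorithm and polynomials $T$ and $q$ such that for every $c\ge1$, every oracle that answers every graph with a $c$-approximate solution, and every instance $(G,\mathcal T,\ell)$, the algorithm runs in time at most $T(|(G,\mathcal T,\ell)|)$, asks the oracle only about graphs that have at most $N(\ell)$ vertices and an encoding of length at most $q(\ell)$, and returns a $(1+\varepsilon)c$-approximate solution for $G$. -/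

import Mathlib

namespace ApproxTuring

/-! ### Strings, programs and running time -/

/-- The strings over which algorithms work, written as binary trees (S-expressions). -/
inductive Data : Type
  | nil : Data
  | cons : Data → Data → Data

namespace Data

/-- The length of a string: the number of nodes of the tree. -/
def size : Data → ℕ
  | nil => 1
  | cons a b => a.size + b.size + 1

def head : Data → Data
  | nil => nil
  | cons a _ => a

def tail : Data → Data
  | nil => nil
  | cons _ b => b

/-- Natural numbers are written in unary, so the length of the code is linear in the number. -/
def ofNat : ℕ → Data
  | 0 => nil
  | n + 1 => cons nil (ofNat n)

def ofList : List Data → Data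
  | [] => nil
  | a :: l => cons a (ofList l)

/-- The code of a list of natural numbers. -/
def ofNatList (l : List ℕ) : Data := ofList (l.map ofNat)

end Data

open Data

/-- Programs of a small Turing complete language over `Data`. A program transforms its input into
its output. `comp p q` runs `p` and then `q`; `pair p q` runs both on the same input and pairs the
results; `ite c p q` branches on whether `c` returns something else than `nil`; `loop c p` iterates
`p` as long as `c` returns something else than `nil`; `eq` compares the two components of its
input; `query` replaces its input by the oracle's answer to it. -/
inductive Prog : Type
  | id : Prog
  | nil : Prog
  | head : Prog
  | tail : Prog
  | eq : Prog
  | pair : Prog → Prog → Prog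
  | comp : Prog → Prog → Prog
  | ite : Prog → Prog → Prog → Prog
  | loop : Prog → Prog → Prog
  | query : Prog

/-- `Exec O Q p x y t`: with oracle `O`, the program `p` halts on input `x` with output `y` after
time `t`, and all oracle queries made on the way satisfy `Q`. Every elementary operation is charged
the length of the string that it reads, and `pair` and `query` also the length of the string that
they write, so time is the time of a Turing machine up to a polynomial. -/
inductive Exec (O : Data → Data) (Q : Data → Prop) : Prog → Data → Data → ℕ → Prop
  | id (x : Data) : Exec O Q .id x x x.size
  | nil (x : Data) : Exec O Q .nil x Data.nil x.size
  | head (x : Data) : Exec O Q .head x x.head x.size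
  | tail (x : Data) : Exec O Q .tail x x.tail x.size
  | eq_true (x : Data) : x.head = x.tail →
      Exec O Q .eq x (Data.cons Data.nil Data.nil) x.size
  | eq_false (x : Data) : x.head ≠ x.tail → Exec O Q .eq x Data.nil x.size
  | pair {p q : Prog} {x y z : Data} {s t : ℕ} : Exec O Q p x y s → Exec O Q q x z t →
      Exec O Q (.pair p q) x (Data.cons y z) (s + t + (Data.cons y z).size)
  | comp {p q : Prog} {x y z : Data} {s t : ℕ} : Exec O Q p x y s → Exec O Q q y z t →
      Exec O Q (.comp p q) x z (s + t + 1)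
  | ite_true {c p q : Prog} {x y z : Data} {s t : ℕ} : Exec O Q c x y s → y ≠ Data.nil →
      Exec O Q p x z t → Exec O Q (.ite c p q) x z (s + t + 1)
  | ite_false {c p q : Prog} {x z : Data} {s t : ℕ} : Exec O Q c x Data.nil s →
      Exec O Q q x z t → Exec O Q (.ite c p q) x z (s + t + 1)
  | loop_done {c p : Prog} {x : Data} {s : ℕ} : Exec O Q c x Data.nil s →
      Exec O Q (.loop c p) x x (s + 1)
  | loop_step {c p : Prog} {x x' y z : Data} {s t u : ℕ} : Exec O Q c x y s → y ≠ Data.nil →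
      Exec O Q p x x' t → Exec O Q (.loop c p) x' z u →
      Exec O Q (.loop c p) x z (s + t + u + 1)
  | query (x : Data) : Q x → Exec O Q .query x (O x) (x.size + (O x).size)

/-- Without any oracle query, `p` turns `x` into `y` in time at most `T(|x|)`. -/
def Prog.RunsIn (p : Prog) (T : Polynomial ℕ) (x y : Data) : Prop :=
  ∃ t : ℕ, Exec (fun _ => Data.nil) (fun _ => False) p x y t ∧ t ≤ T.eval x.size

/-! ### Graphs and tree decompositions -/

/-- A finite simple undirected graph whose vertices are labelled by natural numbers. -/
structure FinGraph where
  verts : Finset ℕ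
  Adj : ℕ → ℕ → Prop
  symm : ∀ u v, Adj u v → Adj v u
  irrefl : ∀ u, ¬ Adj u u
  mem_verts : ∀ u v, Adj u v → u ∈ verts

/-- The graph `G - X`. -/
def FinGraph.deleteVerts (G : FinGraph) (X : Finset ℕ) : FinGraph where
  verts := G.verts \ X
  Adj u v := G.Adj u v ∧ u ∉ X ∧ v ∉ X
  symm u v h := ⟨G.symm u v h.1, h.2.2, h.2.1⟩
  irrefl u h := G.irrefl u h.1
  mem_verts u v h := Finset.mem_sdiff.2 ⟨G.mem_verts u v h.1, h.2.1⟩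

/-- `G` is the disjoint union of `G₁` and `G₂`. -/
def FinGraph.IsDisjointUnion (G G₁ G₂ : FinGraph) : Prop :=
  Disjoint G₁.verts G₂.verts ∧ G.verts = G₁.verts ∪ G₂.verts ∧
    ∀ u v, G.Adj u v ↔ G₁.Adj u v ∨ G₂.Adj u v

/-- `d` is the code of a list of the elements of `X`. -/
def IsSetCode (d : Data) (X : Finset ℕ) : Prop :=
  ∃ l : List ℕ, d = ofNatList l ∧ l.toFinset = X

/-- `d` encodes the graph `G` by a list of its vertices and a list of its edges. -/
def IsGraphCode (d : Data) (G : FinGraph) : Prop :=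
  ∃ (vs : List ℕ) (es : List (ℕ × ℕ)),
    d = cons (ofNatList vs) (ofList (es.map fun e => cons (ofNat e.1) (ofNat e.2))) ∧
    vs.toFinset = G.verts ∧ ∀ u v, G.Adj u v ↔ (u, v) ∈ es ∨ (v, u) ∈ es

/-- A tree decomposition of `G`. -/
structure TreeDecomposition (G : FinGraph) where
  n : ℕ
  tree : SimpleGraph (Fin n)
  isTree : tree.IsTree
  bag : Fin n → Finset ℕ
  mem_verts_iff : ∀ v, v ∈ G.verts ↔ ∃ t, v ∈ bag t
  exists_bag : ∀ u v, G.Adj u v → ∃ t, u ∈ bag t ∧ v ∈ bag t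
  connected : ∀ v ∈ G.verts, (tree.induce {t | v ∈ bag t}).Connected

/-- `d` encodes the tree decomposition `𝒯` by the list of its nodes, each given by its parent and a
list of the vertices in its bag. The nodes are numbered so that the root is node `0` and parents
come before their children; the parent entry of the root is ignored. -/
def IsTreeDecompositionCode {G : FinGraph} (d : Data) (𝒯 : TreeDecomposition G) : Prop :=
  ∃ (par : Fin 𝒯.n → ℕ) (bags : Fin 𝒯.n → List ℕ),
    d = ofList (List.ofFn fun i => cons (ofNat (par i)) (ofNatList (bags i))) ∧
    (∀ i, (bags i).toFinset = 𝒯.bag i) ∧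
    ∀ i j : Fin 𝒯.n, 𝒯.tree.Adj i j ↔
      (i < j ∧ par j = (i : ℕ)) ∨ (j < i ∧ par i = (j : ℕ))

/-- `d` encodes the graph `G` together with a tree decomposition of width at most `ℓ`, and the
number `ℓ`. -/
def IsInstanceCode (d : Data) (G : FinGraph) (ℓ : ℕ) : Prop :=
  ∃ (g τ : Data) (𝒯 : TreeDecomposition G), d = cons g (cons τ (ofNat ℓ)) ∧
    IsGraphCode g G ∧ IsTreeDecompositionCode τ 𝒯 ∧ ∀ t, (𝒯.bag t).card ≤ ℓ + 1

/-! ### Optimization problems on graphs -/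

inductive Goal : Type
  | minimize : Goal
  | maximize : Goal

/-- The value of the strings that are not solutions. -/
noncomputable def Goal.infeasible : Goal → EReal
  | .minimize => ⊤
  | .maximize => ⊥

/-- The optimum of a family of values. -/
noncomputable def Goal.best (goal : Goal) (v : Data → EReal) : EReal :=
  match goal with
  | .minimize => ⨅ s, v s
  | .maximize => ⨆ s, v s

/-- The value `v` is within the factor `ρ` of the optimum `opt`. -/
def Goal.Within (goal : Goal) (ρ : ℝ) (v opt : EReal) : Prop :=
  match goal with
  | .minimize => v ≤ (ρ : EReal) * opt
  | .maximize => opt ≤ (ρ : EReal) * v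

/-- An optimization problem on graphs: a function that assigns a value in `ℝ ∪ {±∞}` to every graph
and every string. The length of a solution is polynomially bounded in the length of the input, and
the value of a string can be compared with a given non-negative rational in polynomial time. -/
structure GraphProblem where
  goal : Goal
  val : FinGraph → Data → EReal
  size_le : ∃ b : Polynomial ℕ, ∀ (g : Data) (G : FinGraph) (s : Data), IsGraphCode g G →
    val G s ≠ goal.infeasible → s.size ≤ b.eval g.size
  val_polyTime : ∃ (A : Prog) (T : Polynomial ℕ), ∀ (g : Data) (G : FinGraph) (s : Data) (a b : ℕ),
    IsGraphCode g G → 0 < b →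
    ∃ y : Data, A.RunsIn T (cons g (cons s (cons (ofNat a) (ofNat b)))) y ∧
      (y ≠ Data.nil ↔ val G s ≤ (((a : ℝ) / (b : ℝ) : ℝ) : EReal))

namespace GraphProblem

variable (P : GraphProblem)

/-- `s` is a solution for `G`. -/
def IsSolution (G : FinGraph) (s : Data) : Prop := P.val G s ≠ P.goal.infeasible

/-- The optimal value of `G`. -/
noncomputable def opt (G : FinGraph) : EReal := P.goal.best (P.val G)

/-- `s` is a `c`-approximate solution for `G`. -/
def IsApproxSolution (c : ℝ) (G : FinGraph) (s : Data) : Prop :=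
  P.IsSolution G s ∧ P.goal.Within c (P.val G s) (P.opt G)

/-- The parameterized problem `P^⊥`, in which values above the parameter are not distinguished. -/
noncomputable def valBot (G : FinGraph) (m : ℕ) (s : Data) : EReal :=
  min (P.val G s) (((m : ℝ) + 1 : ℝ) : EReal)

/-- The optimal value of `(G, m)` for `P^⊥`. -/
noncomputable def optBot (G : FinGraph) (m : ℕ) : EReal := P.goal.best (P.valBot G m)

/-- `P^⊥`, parameterized by the sum `m = k + ℓ` of the solution value and the width of the given
tree decomposition, has an `α`-approximate kernel with at most `h m` vertices: a polynomial-time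
reduction algorithm `R` and a polynomial-time solution-lifting algorithm `L`. As for every kernel,
the length of the reduced instance and its parameter are bounded in terms of `m`, here by a
polynomial. The ratio of a solution to the optimum may grow by the factor `α` at most. -/
def HasApproxKernel (α : ℝ) (h : ℕ → ℕ) : Prop :=
  ∃ (R L : Prog) (T q : Polynomial ℕ), ∀ (d : Data) (G : FinGraph) (m : ℕ),
    IsInstanceCode d G m →
    ∃ (g' : Data) (G' : FinGraph) (m' : ℕ),
      R.RunsIn T d (cons g' (ofNat m')) ∧ IsGraphCode g' G' ∧
      G'.verts.card ≤ h m ∧ g'.size ≤ q.eval m ∧ m' ≤ q.eval m ∧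
      ∀ s' : Data, P.IsSolution G' s' →
        ∃ s : Data, L.RunsIn T (cons d (cons (cons g' (ofNat m')) s')) s ∧
          ∀ ρ : ℝ, 1 ≤ ρ → P.goal.Within ρ (P.valBot G' m' s') (P.optBot G' m') →
            P.goal.Within (α * ρ) (P.valBot G m s) (P.optBot G m)

/-- `P` has a `φ`-approximation algorithm. -/
def HasApproxAlgorithm (φ : ℝ → ℕ → ℝ) : Prop :=
  ∃ (A : Prog) (T : Polynomial ℕ), ∀ (d : Data) (G : FinGraph) (ℓ : ℕ), IsInstanceCode d G ℓ →
    ∃ s : Data, A.RunsIn T d s ∧ P.IsSolution G s ∧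
      match P.goal with
      | .minimize => ∃ r : ℝ, P.opt G = (r : EReal) ∧ P.val G s ≤ ((φ r ℓ : ℝ) : EReal)
      | .maximize => ∃ r : ℝ, P.val G s = (r : EReal) ∧ P.opt G ≤ ((φ r ℓ : ℝ) : EReal)

/-- `P` is additive over disjoint unions, and solutions can be united and split in polynomial
time. -/
structure IsAdditive : Prop where
  opt_empty : ∀ G : FinGraph, G.verts = ∅ → P.opt G = 0
  opt_union : ∀ G G₁ G₂ : FinGraph, G.IsDisjointUnion G₁ G₂ → P.opt G = P.opt G₁ + P.opt G₂
  unite : ∃ (A : Prog) (T : Polynomial ℕ), ∀ (G G₁ G₂ : FinGraph) (g₁ g₂ s₁ s₂ : Data),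
    G.IsDisjointUnion G₁ G₂ → IsGraphCode g₁ G₁ → IsGraphCode g₂ G₂ →
    P.IsSolution G₁ s₁ → P.IsSolution G₂ s₂ →
    ∃ s : Data, A.RunsIn T (cons g₁ (cons g₂ (cons s₁ s₂))) s ∧ P.IsSolution G s ∧
      P.val G s = P.val G₁ s₁ + P.val G₂ s₂
  split : ∃ (A : Prog) (T : Polynomial ℕ), ∀ (G G₁ G₂ : FinGraph) (g₁ g₂ s : Data),
    G.IsDisjointUnion G₁ G₂ → IsGraphCode g₁ G₁ → IsGraphCode g₂ G₂ → P.IsSolution G s →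
    ∃ s₁ s₂ : Data, A.RunsIn T (cons g₁ (cons g₂ s)) (cons s₁ s₂) ∧
      P.IsSolution G₁ s₁ ∧ P.IsSolution G₂ s₂ ∧ P.val G s = P.val G₁ s₁ + P.val G₂ s₂

/-- Deleting a set `X` of vertices does not increase the optimum and decreases it by at most
`f |X|`, and solutions for `G - X` can be extended to solutions for `G` accordingly. -/
structure HasBoundedLoss (f : ℕ → ℝ) : Prop where
  opt_le : ∀ (G : FinGraph) (X : Finset ℕ), X ⊆ G.verts →
    P.opt G ≤ P.opt (G.deleteVerts X) + ((f X.card : ℝ) : EReal)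
  le_opt : ∀ (G : FinGraph) (X : Finset ℕ), X ⊆ G.verts → P.opt (G.deleteVerts X) ≤ P.opt G
  extend_min : P.goal = .minimize → ∃ (A : Prog) (T : Polynomial ℕ),
    ∀ (G : FinGraph) (X : Finset ℕ) (g x s' : Data), X ⊆ G.verts → IsGraphCode g G →
      IsSetCode x X → P.IsSolution (G.deleteVerts X) s' →
      ∃ s : Data, A.RunsIn T (cons g (cons x s')) s ∧ P.IsSolution G s ∧
        P.val G s ≤ P.val (G.deleteVerts X) s' + ((f X.card : ℝ) : EReal)
  extend_max : P.goal = .maximize → ∀ (G : FinGraph) (X : Finset ℕ) (s : Data), X ⊆ G.verts →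
    P.IsSolution (G.deleteVerts X) s →
    P.IsSolution G s ∧ P.val G s = P.val (G.deleteVerts X) s

/-- `P` is friendly, with loss `f`, kernels of size `h` and a `φ`-approximation algorithm. -/
structure IsFriendly (f : ℕ → ℝ) (h : ℝ → ℕ → ℕ) (φ : ℝ → ℕ → ℝ) : Prop where
  additive : P.IsAdditive
  f_polynomial : ∃ p : Polynomial ℝ, ∀ n : ℕ, f n = p.eval (n : ℝ)
  f_mono : Monotone f
  loss : P.HasBoundedLoss f
  h_polynomial : ∀ δ : ℝ, 0 < δ → ∃ p : Polynomial ℕ, ∀ m : ℕ, h δ m ≤ p.eval m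
  h_mono : ∀ δ : ℝ, 0 < δ → Monotone (h δ)
  kernel : ∀ δ : ℝ, 0 < δ → P.HasApproxKernel (1 + δ) (h δ)
  φ_polynomial : ∃ p : MvPolynomial (Fin 2) ℝ, ∀ (s : ℝ) (ℓ : ℕ),
    φ s ℓ = MvPolynomial.eval ![s, (ℓ : ℝ)] p
  φ_mono : ∀ ℓ : ℕ, Monotone fun s => φ s ℓ
  φ_mul_le : ∀ (α k : ℝ) (ℓ : ℕ), 1 < α → 0 ≤ k → α * φ k ℓ ≤ φ (α * k) ℓ
  approx : P.HasApproxAlgorithm φ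

/-- `O` is a `c`-approximate oracle for `P`. -/
def IsApproxOracle (c : ℝ) (O : Data → Data) : Prop :=
  ∀ (g : Data) (G : FinGraph), IsGraphCode g G → P.IsApproxSolution c G (O g)

/-- `P`, parameterized by the width `ℓ` of the given tree decomposition, has an `α`-approximate
Turing kernel with at most `N ℓ` vertices: one polynomial-time oracle algorithm that, for every
`c ≥ 1` and every `c`-approximate oracle, finds an `α c`-approximate solution and only asks the
oracle about graphs with at most `N ℓ` vertices (whose codes have length polynomial in `ℓ`). -/
def HasApproxTuringKernel (α : ℝ) (N : ℕ → ℕ) : Prop :=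
  ∃ (B : Prog) (T q : Polynomial ℕ), ∀ (c : ℝ) (O : Data → Data), 1 ≤ c → P.IsApproxOracle c O →
    ∀ (d : Data) (G : FinGraph) (ℓ : ℕ), IsInstanceCode d G ℓ →
    ∃ (s : Data) (t : ℕ),
      Exec O (fun x => ∃ G' : FinGraph, IsGraphCode x G' ∧ G'.verts.card ≤ N ℓ ∧
        x.size ≤ q.eval ℓ) B d s t ∧
      t ≤ T.eval d.size ∧ P.IsApproxSolution (α * c) G s

end GraphProblem

end ApproxTuring

namespace ApproxTuring

open Data

/-! ### Running time and output length -/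

/-! The nodes of the tree decomposition are treated from the leaves to the root, with a set `R` of
vertices not yet cut off. At a node `k`, let `H` consist of the vertices of `R` that occur only in
bags of the subtree of `k`; all neighbours of `H` occur in bags of that subtree. The solver
(`exists_solver`) runs the `φ`-approximation on `G[H]` and compares its value with a threshold. A
value above it certifies an optimum larger than `κ = 3 f(ℓ+1)/ε` (heavy). Otherwise the optimum is
at most `M + 1` for some `M ≤ φ(6 f(ℓ+1)/ε + f 1, ℓ)`, so the truncation in `P^⊥` with parameter `M
+ ℓ` is harmless, and kernelization, one query and lifting give a `(1+ε/3)c`-approximate solution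
(light).

A light `H` with its solution replaces the earlier parts that meet it. At a heavy node the remaining
vertices of the bag are set aside as a separator, the whole subtree leaves `R`, and the parts found
below are kept (`SweepInvariant.light`, `SweepInvariant.cut`). Heavy sets are disjoint and pairwise
non-adjacent, so `r` cuts force `r κ ≤ OPT(G)` by additivity, and the separators cost only `r f(ℓ+1)
≤ (ε/3) OPT(G)` in total. After the root, every vertex lies in a part or a separator
(`SweepInvariant.cover`). The parts are pairwise disjoint and non-adjacent, so their solutions unite
(`exists_uniteAll`) to a `(1+ε/3)c`-approximate solution of `G` minus the separators, which is
extended to `G` (`exists_extendAll`). The final ratio (`nearOpt_of_cuts`) follows from `(1+ε/3)c +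
ε/3 ≤ (1+ε)c` for minimization and from `1+ε/3 ≤ (1-ε/3)(1+ε)`, valid for `ε ≤ 1`, for maximization.

Two computational points remain. Programs and their correctness are built together through `Alg`, a
weakest-precondition calculus with polynomial running time. The thresholds come from real
polynomials whose coefficients need not be computable; they are replaced by rational values correct
up to the factor `4/3`, and the gap between `3` and `6` in front of `f(ℓ+1)/ε` pays for this. -/

@[simp] theorem head_cons (a b : Data) : (cons a b).head = a := rfl

@[simp] theorem tail_cons (a b : Data) : (cons a b).tail = b := rfl

theorem Data.size_pos (x : Data) : 0 < x.size := by
  cases x <;> simp [Data.size]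

theorem Data.size_head_le (x : Data) : x.head.size ≤ x.size := by
  cases x <;> simp [Data.size, Data.head]; omega

theorem Data.size_tail_le (x : Data) : x.tail.size ≤ x.size := by
  cases x <;> simp [Data.size, Data.tail]; omega

theorem Exec.size_le_time {O : Data → Data} {Q : Data → Prop} {p : Prog} {x y : Data} {t : ℕ}
    (h : Exec O Q p x y t) : x.size ≤ t := by
  induction h <;> omega

/-- Intermediate results are bounded by the time spent, which is what makes compositions of
polynomial-time programs polynomial. The slack `2` is attained by `eq` on `nil`, which writes a
string of size 3 in time 1. -/
theorem Exec.size_out_le {O : Data → Data} {Q : Data → Prop} {p : Prog} {x y : Data} {t : ℕ}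
    (h : Exec O Q p x y t) : y.size ≤ t + 2 := by
  induction h with
  | id x => omega
  | nil x => simp [Data.size]
  | head x => have := x.size_head_le; omega
  | tail x => have := x.size_tail_le; omega
  | eq_true x _ => have := x.size_pos; simp [Data.size]; omega
  | eq_false x _ => simp [Data.size]
  | pair => omega
  | comp => omega
  | ite_true => omega
  | ite_false => omega
  | loop_done hc => have := hc.size_le_time; omega
  | loop_step => omega
  | query x _ => omega

/-- A run without oracle queries is a run with respect to every oracle. -/
theorem Exec.of_no_query {O O' : Data → Data} {Q Q' : Data → Prop} (hQ : ∀ x, ¬ Q x)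
    {p : Prog} {x y : Data} {t : ℕ} (h : Exec O Q p x y t) : Exec O' Q' p x y t := by
  induction h with
  | id x => exact .id x
  | nil x => exact .nil x
  | head x => exact .head x
  | tail x => exact .tail x
  | eq_true x h => exact .eq_true x h
  | eq_false x h => exact .eq_false x h
  | pair _ _ h₁ h₂ => exact .pair h₁ h₂
  | comp _ _ h₁ h₂ => exact .comp h₁ h₂
  | ite_true _ hy _ h₁ h₂ => exact .ite_true h₁ hy h₂
  | ite_false _ _ h₁ h₂ => exact .ite_false h₁ h₂
  | loop_done _ h₁ => exact .loop_done h₁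
  | loop_step _ hy _ _ h₁ h₂ h₃ => exact .loop_step h₁ hy h₂ h₃
  | query x h => exact absurd h (hQ x)

theorem eval_mono (T : Polynomial ℕ) {m n : ℕ} (h : m ≤ n) : T.eval m ≤ T.eval n := by
  rw [Polynomial.eval_eq_sum, Polynomial.eval_eq_sum, Polynomial.sum, Polynomial.sum]
  exact Finset.sum_le_sum fun i _ => Nat.mul_le_mul_left _ (Nat.pow_le_pow_left h i)

/-! ### Polynomial-time implementable specifications -/

/-- A specification in weakest-precondition form: `S O Q x Φ` says under which circumstances an
output satisfying `Φ` is promised on input `x`, with the oracle `O` and admissible queries `Q`. -/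
abbrev Spec := (Data → Data) → (Data → Prop) → Data → (Data → Prop) → Prop

/-- The specification `S` is met by a polynomial-time oracle program. -/
def Alg (S : Spec) : Prop :=
  ∃ (p : Prog) (T : Polynomial ℕ), ∀ O Q x Φ, S O Q x Φ →
    ∃ y t, Exec O Q p x y t ∧ t ≤ T.eval x.size ∧ Φ y

/-- The function `f` is computable in polynomial time. -/
@[fun_prop]
def PolyTime (f : Data → Data) : Prop := Alg fun _ _ x Φ => Φ (f x)

namespace Alg

theorem weaken {S S' : Spec} (h : Alg S) (h' : ∀ O Q x Φ, S' O Q x Φ → S O Q x Φ) : Alg S' := by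
  obtain ⟨p, T, hp⟩ := h
  exact ⟨p, T, fun O Q x Φ hS => hp O Q x Φ (h' O Q x Φ hS)⟩

/-- A `Spec` is not required to be monotone in its postcondition. This closure supplies
monotonicity, so that a loop body may promise more than the loop invariant asks for. -/
theorem upward {S : Spec} (h : Alg S) :
    Alg fun O Q x Φ => ∃ Ψ : Data → Prop, S O Q x Ψ ∧ ∀ y, Ψ y → Φ y := by
  obtain ⟨p, T, hp⟩ := h
  refine ⟨p, T, fun O Q x Φ ⟨Ψ, hS, hΨ⟩ => ?_⟩
  obtain ⟨y, t, hy, ht, h⟩ := hp O Q x Ψ hS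
  exact ⟨y, t, hy, ht, hΨ y h⟩

theorem comp {S₁ S₂ : Spec} (h₁ : Alg S₁) (h₂ : Alg S₂) :
    Alg fun O Q x Φ => S₁ O Q x fun y => S₂ O Q y Φ := by
  obtain ⟨p, T, hp⟩ := h₁
  obtain ⟨q, U, hq⟩ := h₂
  refine ⟨.comp p q, T + U.comp (T + 2) + 1, fun O Q x Φ hS => ?_⟩
  obtain ⟨y, s, hy, hs, hS⟩ := hp O Q x _ hS
  obtain ⟨z, t, hz, ht, hΦ⟩ := hq O Q y _ hS
  refine ⟨z, _, .comp hy hz, ?_, hΦ⟩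
  have := eval_mono U (show y.size ≤ T.eval x.size + 2 by have := hy.size_out_le; omega)
  simp only [Polynomial.eval_add, Polynomial.eval_comp, Polynomial.eval_one,
    Polynomial.eval_ofNat]
  omega

theorem pair {S₁ S₂ : Spec} (h₁ : Alg S₁) (h₂ : Alg S₂) :
    Alg fun O Q x Φ => S₁ O Q x fun y => S₂ O Q x fun z => Φ (cons y z) := by
  obtain ⟨p, T, hp⟩ := h₁
  obtain ⟨q, U, hq⟩ := h₂
  refine ⟨.pair p q, T + U + (T + U + 5), fun O Q x Φ hS => ?_⟩
  obtain ⟨y, s, hy, hs, hS⟩ := hp O Q x _ hS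
  obtain ⟨z, t, hz, ht, hΦ⟩ := hq O Q x _ hS
  refine ⟨_, _, .pair hy hz, ?_, hΦ⟩
  have := hy.size_out_le
  have := hz.size_out_le
  simp only [Polynomial.eval_add, Polynomial.eval_ofNat, Data.size]
  omega

theorem ite {S S₁ S₂ : Spec} (h : Alg S) (h₁ : Alg S₁) (h₂ : Alg S₂) :
    Alg fun O Q x Φ => S O Q x fun y =>
      (y ≠ Data.nil → S₁ O Q x Φ) ∧ (y = Data.nil → S₂ O Q x Φ) := by
  obtain ⟨c, R, hc⟩ := h
  obtain ⟨p, T, hp⟩ := h₁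
  obtain ⟨q, U, hq⟩ := h₂
  refine ⟨.ite c p q, R + T + U + 1, fun O Q x Φ hS => ?_⟩
  obtain ⟨y, s, hy, hs, hS₁, hS₂⟩ := hc O Q x _ hS
  simp only [Polynomial.eval_add, Polynomial.eval_one]
  by_cases hn : y = Data.nil
  · obtain ⟨z, t, hz, ht, hΦ⟩ := hq O Q x _ (hS₂ hn)
    subst hn
    exact ⟨z, _, .ite_false hy hz, by omega, hΦ⟩
  · obtain ⟨z, t, hz, ht, hΦ⟩ := hp O Q x _ (hS₁ hn)
    exact ⟨z, _, .ite_true hy hn hz, by omega, hΦ⟩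

/-- The oracle is arbitrary and reading its answer costs time, so a length bound is part of the
precondition. For solutions it comes from `size_le`. -/
theorem query (b : Polynomial ℕ) :
    Alg fun O Q x Φ => Q x ∧ (O x).size ≤ b.eval x.size ∧ Φ (O x) :=
  ⟨.query, Polynomial.X + b, fun O Q x Φ h =>
    ⟨O x, _, .query x h.1, by simpa using h.2.1, h.2.2⟩⟩

/-- A program of the language that needs no oracle, with a postcondition. -/
theorem ofRunsIn (p : Prog) (T : Polynomial ℕ) :
    Alg fun _ _ x Φ => ∃ y, p.RunsIn T x y ∧ Φ y :=
  ⟨p, T, fun _ _ _ _ ⟨y, ⟨t, ht, hT⟩, hΦ⟩ =>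
    ⟨y, t, ht.of_no_query fun _ h => h, hT, hΦ⟩⟩

/-- Iteration: `J k y` says that `y` is an admissible state with `k` iterations to go. -/
theorem loop {c : Data → Data} (hc : PolyTime c) {S : Spec} (h : Alg S) (K B : Polynomial ℕ) :
    Alg fun O Q x Φ => ∃ (J : ℕ → Data → Prop) (n : ℕ), n ≤ K.eval x.size ∧ J n x ∧
      (∀ k y, J k y → y.size ≤ B.eval x.size) ∧
      (∀ k y, J (k + 1) y → c y ≠ Data.nil ∧ S O Q y (J k)) ∧
      (∀ y, J 0 y → c y = Data.nil ∧ Φ y) := by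
  obtain ⟨p, T, hp⟩ := hc
  obtain ⟨q, U, hq⟩ := h
  -- All states have size at most `B |x|`, so each round costs at most the second factor; the extra
  -- round is the final failing test.
  refine ⟨.loop p q, (K + 1) * (T.comp B + U.comp B + 1), ?_⟩
  rintro O Q x Φ ⟨J, n, hn, hx, hB, hstep, hdone⟩
  set M := T.eval (B.eval x.size) + U.eval (B.eval x.size) + 1 with hM
  have key : ∀ n y, J n y → ∃ z t, Exec O Q (.loop p q) y z t ∧ t ≤ (n + 1) * M ∧ Φ z := by
    intro n
    induction n with
    | zero =>
      intro y hy
      obtain ⟨hc0, hΦ⟩ := hdone y hy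
      obtain ⟨z, t, hz, ht, rfl⟩ := hp O Q y (· = c y) rfl
      rw [hc0] at hz
      refine ⟨y, _, .loop_done hz, ?_, hΦ⟩
      have := eval_mono T (hB 0 y hy)
      omega
    | succ n ih =>
      intro y hy
      obtain ⟨hc0, hS⟩ := hstep n y hy
      obtain ⟨z, t, hz, ht, rfl⟩ := hp O Q y (· = c y) rfl
      obtain ⟨y', s, hy', hs, hJ⟩ := hq O Q y _ hS
      obtain ⟨w, u, hw, hu, hΦ⟩ := ih y' hJ
      refine ⟨w, _, .loop_step hz hc0 hy' hw, ?_, hΦ⟩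
      have h₁ := eval_mono T (hB _ y hy)
      have h₂ := eval_mono U (hB _ y hy)
      rw [Nat.succ_mul (n + 1)]
      omega
  obtain ⟨z, t, hz, ht, hΦ⟩ := key n x hx
  refine ⟨z, t, hz, ht.trans ?_, hΦ⟩
  simp only [Polynomial.eval_mul, Polynomial.eval_add, Polynomial.eval_one, Polynomial.eval_comp]
  exact Nat.mul_le_mul_right _ (by omega)

end Alg

/-! ### Polynomial-time functions -/

open scoped Classical in
/-- A truth value as a string. -/
noncomputable def ofProp (p : Prop) : Data := if p then cons .nil .nil else .nil

theorem ofProp_ne_nil {p : Prop} : ofProp p ≠ .nil ↔ p := by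
  by_cases h : p <;> simp [ofProp, h]

theorem ofProp_eq_nil {p : Prop} : ofProp p = .nil ↔ ¬ p := by
  by_cases h : p <;> simp [ofProp, h]

/-- The predicate `p` is decidable in polynomial time. -/
@[fun_prop]
def PolyDec (p : Data → Prop) : Prop := PolyTime fun x => ofProp (p x)

namespace PolyTime

theorem size_le {f : Data → Data} (hf : PolyTime f) :
    ∃ B : Polynomial ℕ, ∀ x, (f x).size ≤ B.eval x.size := by
  obtain ⟨p, T, hp⟩ := hf
  refine ⟨T + 2, fun x => ?_⟩
  obtain ⟨y, t, hy, ht, rfl⟩ := hp (fun _ => .nil) (fun _ => False) x (· = f x) rfl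
  have := hy.size_out_le
  simp only [Polynomial.eval_add, Polynomial.eval_ofNat]
  omega

@[fun_prop]
theorem id : PolyTime fun x => x :=
  ⟨.id, .X, fun _ _ x _ h => ⟨x, _, .id x, by simp, h⟩⟩

theorem nil : PolyTime fun _ => .nil :=
  ⟨.nil, .X, fun _ _ x _ h => ⟨.nil, _, .nil x, by simp, h⟩⟩

theorem head' : PolyTime Data.head :=
  ⟨.head, .X, fun _ _ x _ h => ⟨_, _, .head x, by simp, h⟩⟩

theorem tail' : PolyTime Data.tail :=
  ⟨.tail, .X, fun _ _ x _ h => ⟨_, _, .tail x, by simp, h⟩⟩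

@[fun_prop]
theorem comp {g f : Data → Data} (hg : PolyTime g) (hf : PolyTime f) :
    PolyTime fun x => g (f x) :=
  Alg.comp hf hg

@[fun_prop]
theorem head {f : Data → Data} (hf : PolyTime f) : PolyTime fun x => (f x).head := head'.comp hf

@[fun_prop]
theorem tail {f : Data → Data} (hf : PolyTime f) : PolyTime fun x => (f x).tail := tail'.comp hf

@[fun_prop]
theorem cons {f g : Data → Data} (hf : PolyTime f) (hg : PolyTime g) :
    PolyTime fun x => Data.cons (f x) (g x) :=
  Alg.pair hf hg

@[fun_prop]
theorem const (d : Data) : PolyTime fun _ => d := by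
  induction d with
  | nil => exact nil
  | cons a b ha hb => exact cons ha hb

theorem of_eq {f g : Data → Data} (hf : PolyTime f) (h : ∀ x, f x = g x) : PolyTime g :=
  (funext h : f = g) ▸ hf

@[fun_prop]
theorem ite {p : Data → Prop} {inst : ∀ x, Decidable (p x)} {f g : Data → Data}
    (hp : PolyDec p) (hf : PolyTime f)
    (hg : PolyTime g) : PolyTime fun x => if p x then f x else g x :=
  (Alg.ite hp hf hg).weaken fun O Q x Φ h => by
    refine ⟨fun hn => ?_, fun hn => ?_⟩
    · simpa only [if_pos (ofProp_ne_nil.1 hn)] using h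
    · simpa only [if_neg (ofProp_eq_nil.1 hn)] using h

end PolyTime

namespace PolyDec

@[fun_prop]
theorem eq {f g : Data → Data} (hf : PolyTime f) (hg : PolyTime g) :
    PolyDec fun x => f x = g x := by
  have : PolyTime fun x => ofProp (x.head = x.tail) := by
    refine ⟨.eq, .X, fun _ _ x _ h => ?_⟩
    by_cases hx : x.head = x.tail
    · exact ⟨_, _, .eq_true x hx, by simp, by simpa [ofProp, hx] using h⟩
    · exact ⟨_, _, .eq_false x hx, by simp, by simpa [ofProp, hx] using h⟩
  exact this.comp (hf.cons hg)

@[fun_prop]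
theorem not {p : Data → Prop} (hp : PolyDec p) : PolyDec fun x => ¬ p x :=
  (PolyTime.ite (inst := fun _ => Classical.propDecidable _) hp (.const .nil) (.const (cons .nil .nil))).of_eq fun x => by
    by_cases h : p x <;> simp [ofProp, h]

@[fun_prop]
theorem and {p q : Data → Prop} (hp : PolyDec p) (hq : PolyDec q) : PolyDec fun x => p x ∧ q x :=
  (PolyTime.ite (inst := fun _ => Classical.propDecidable _) hp hq (.const .nil)).of_eq fun x => by
    by_cases h : p x <;> by_cases h' : q x <;> simp [ofProp, h, h']

@[fun_prop]
theorem or {p q : Data → Prop} (hp : PolyDec p) (hq : PolyDec q) : PolyDec fun x => p x ∨ q x :=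
  (PolyTime.ite (inst := fun _ => Classical.propDecidable _) hp (.const (cons .nil .nil)) hq).of_eq fun x => by
    by_cases h : p x <;> by_cases h' : q x <;> simp [ofProp, h, h']

theorem comp {p : Data → Prop} {f : Data → Data} (hp : PolyDec p) (hf : PolyTime f) :
    PolyDec fun x => p (f x) :=
  PolyTime.comp hp hf

end PolyDec

/-! ### Strings as lists -/

/-- Every string is the code of a list of strings. -/
def Data.toList : Data → List Data
  | .nil => []
  | .cons a l => a :: l.toList

@[simp]
theorem toList_ofList (l : List Data) : (ofList l).toList = l := by
  induction l with
  | nil => rfl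
  | cons a l ih => simp [ofList, Data.toList, ih]

@[simp]
theorem ofList_toList (d : Data) : ofList d.toList = d := by
  induction d with
  | nil => rfl
  | cons a l _ ih => simp [ofList, Data.toList, ih]

theorem length_toList_le (d : Data) : d.toList.length ≤ d.size := by
  induction d with
  | nil => simp [Data.toList]
  | cons a l _ ih => simp [Data.toList, Data.size]; omega

theorem size_le_of_mem_toList {a d : Data} (h : a ∈ d.toList) : a.size ≤ d.size := by
  induction d with
  | nil => simp [Data.toList] at h
  | cons b l _ ih =>
    simp only [Data.toList, List.mem_cons] at h
    rcases h with rfl | h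
    · simp [Data.size]; omega
    · have := ih h
      simp [Data.size]; omega

/-- A fold over the list `x.tail.head` with start value `x.tail.tail` and environment `x.head`;
`I l s` says that `s` is an admissible state when the list `l` remains to be processed. -/
theorem Alg.foldl {S : Spec} (h : Alg S) (B : Polynomial ℕ) :
    Alg fun O Q x Φ => ∃ I : List Data → Data → Prop, I x.tail.head.toList x.tail.tail ∧
      (∀ a l s, I (a :: l) s → S O Q (cons x.head (cons a s)) (I l)) ∧
      (∀ l s, I l s → s.size ≤ B.eval x.size) ∧ (∀ s, I [] s → Φ s) := by
  have hc : PolyTime fun x => x.tail.head := by fun_prop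
  have hprep : PolyTime fun y => cons y.head (cons y.tail.head.head y.tail.tail) := by fun_prop
  have h₁ : PolyTime fun y => y.head := by fun_prop
  have h₂ : PolyTime fun y => y.tail.head.tail := by fun_prop
  have hbody := Alg.pair h₁ (Alg.pair h₂ (Alg.comp hprep h.upward))
  have hout : PolyTime fun y => y.tail.tail := by fun_prop
  refine ((Alg.loop hc hbody .X (2 * .X + B + 2)).comp hout).weaken ?_
  rintro O Q x Φ ⟨I, hI, hstep, hB, hdone⟩
  have hxh := x.size_head_le
  have hxt := x.tail.size_head_le.trans x.size_tail_le
  refine ⟨fun k y => ∃ l s, y.head = x.head ∧ y.tail.head = ofList l ∧ y.tail.tail = s ∧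
    l.length = k ∧ (ofList l).size ≤ x.size ∧ y.size ≤ 2 * x.size + B.eval x.size + 2 ∧ I l s,
    x.tail.head.toList.length, ?_, ?_, ?_, ?_, ?_⟩
  · have := length_toList_le x.tail.head
    simp only [Polynomial.eval_X]; omega
  · exact ⟨x.tail.head.toList, x.tail.tail, rfl, by simp, rfl, rfl, by simpa, by omega, hI⟩
  · rintro k y ⟨l, s, -, -, -, -, -, hy, -⟩
    simpa using hy
  · rintro k y ⟨l, s, hy₁, hy₂, hy₃, hk, hl, -, hI⟩
    rcases l with _ | ⟨a, l⟩
    · simp at hk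
    simp only [ofList, Data.size] at hl hy₂
    refine ⟨by simp [hy₂], I l, ?_, fun s' hs' => ⟨l, s', ?_, ?_, ?_, ?_, ?_, ?_, hs'⟩⟩
    · simpa [hy₁, hy₂, hy₃] using hstep a l s hI
    · simpa using hy₁
    · simp [hy₂]
    · simp
    · simpa using hk
    · omega
    · have := hB l s' hs'
      simp only [Data.size, hy₁, hy₂, tail_cons]
      omega
  · rintro y ⟨l, s, -, hy₂, rfl, hk, -, -, hI⟩
    obtain rfl := List.length_eq_zero_iff.1 hk
    exact ⟨hy₂, hdone _ hI⟩

@[simp] theorem toList_nil : Data.nil.toList = [] := rfl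

@[simp] theorem toList_cons (a l : Data) : (cons a l).toList = a :: l.toList := rfl

theorem size_ofList_sublist {l₁ l₂ : List Data} (h : l₁.Sublist l₂) :
    (ofList l₁).size ≤ (ofList l₂).size := by
  induction h with
  | slnil => rfl
  | cons a _ ih => simp only [ofList, Data.size]; omega
  | cons_cons a _ ih => simp only [ofList, Data.size]; omega

namespace PolyTime

/-- A polynomial-time step could double the state and grow exponentially under iteration. Growth by
an additive amount depending only on the environment and the list element excludes this. -/
theorem foldl {f : Data → Data → Data → Data} {l s₀ : Data → Data} (hl : PolyTime l)
    (hs₀ : PolyTime s₀) (hf : PolyTime fun y => f y.head y.tail.head y.tail.tail)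
    (hB : ∃ B : Polynomial ℕ, ∀ x a s, (f x a s).size ≤ s.size + B.eval (x.size + a.size)) :
    PolyTime fun x => (l x).toList.foldl (fun s a => f x a s) (s₀ x) := by
  obtain ⟨B, hB⟩ := hB
  have hin : PolyTime fun x => Data.cons x (Data.cons (l x) (s₀ x)) := by fun_prop
  refine (Alg.comp hin (Alg.foldl hf (.X + .X * B.comp (2 * .X)))).weaken ?_
  intro O Q x Φ hΦ
  set n := (Data.cons x (Data.cons (l x) (s₀ x))).size with hn
  have hn' : n = x.size + ((l x).size + (s₀ x).size + 1) + 1 := rfl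
  -- The last conjunct is a potential: each element removed from the remaining list pays `B (2 * n)`
  -- for the growth of the state.
  refine ⟨fun k s => k.foldl (fun s a => f x a s) s =
    (l x).toList.foldl (fun s a => f x a s) (s₀ x) ∧ (ofList k).size ≤ (l x).size ∧
    s.size + (ofList k).size * B.eval (2 * n) ≤ (s₀ x).size + (l x).size * B.eval (2 * n),
    ⟨rfl, by simp, by simp⟩, ?_, ?_, ?_⟩
  · rintro a k s ⟨h₁, h₂, h₃⟩
    simp only [ofList, Data.size] at h₂ h₃
    refine ⟨h₁, by omega, ?_⟩
    have h₄ := hB x a s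
    have h₅ := eval_mono B (show x.size + a.size ≤ 2 * n by omega)
    have h₆ : (a.size + (ofList k).size + 1) * B.eval (2 * n) =
      a.size * B.eval (2 * n) + (ofList k).size * B.eval (2 * n) + B.eval (2 * n) := by ring
    simp only [head_cons, tail_cons]
    omega
  · rintro k s ⟨-, -, h⟩
    have : (l x).size * B.eval (2 * n) ≤ n * B.eval (2 * n) := Nat.mul_le_mul_right _ (by omega)
    simp only [Polynomial.eval_add, Polynomial.eval_X, Polynomial.eval_mul, Polynomial.eval_comp,
      Polynomial.eval_ofNat, ← hn]
    omega
  · rintro s ⟨h, -, -⟩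
    simp only [List.foldl_nil] at h
    rwa [h]

@[fun_prop]
theorem reverse {l : Data → Data} (hl : PolyTime l) :
    PolyTime fun x => ofList (l x).toList.reverse := by
  refine (foldl (f := fun _ a s => Data.cons a s) hl (.const .nil) (by fun_prop)
    ⟨.X + 1, fun x a s => ?_⟩).of_eq fun x => ?_
  · simp [Data.size]; omega
  · have : ∀ (l : List Data) (s : Data),
        l.foldl (fun s a => Data.cons a s) s = ofList (l.reverse ++ s.toList) := by
      intro l
      induction l with
      | nil => simp
      | cons a l ih => intro s; simp [ih]
    simp [this]

theorem foldr {f : Data → Data → Data → Data} {l s₀ : Data → Data} (hl : PolyTime l)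
    (hs₀ : PolyTime s₀) (hf : PolyTime fun y => f y.head y.tail.head y.tail.tail)
    (hB : ∃ B : Polynomial ℕ, ∀ x a s, (f x a s).size ≤ s.size + B.eval (x.size + a.size)) :
    PolyTime fun x => (l x).toList.foldr (f x) (s₀ x) :=
  (foldl hl.reverse hs₀ hf hB).of_eq fun x => by simp

theorem filter {p : Data → Data → Prop} {inst : ∀ x a, Decidable (p x a)} {l : Data → Data}
    (hl : PolyTime l)
    (hp : PolyDec fun y => p y.head y.tail) :
    PolyTime fun x => ofList ((l x).toList.filter fun a => p x a) := by
  have hp' : PolyDec fun y => p y.head y.tail.head :=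
    (hp.comp (f := fun y => .cons y.head y.tail.head) (by fun_prop))
  refine (foldr (f := fun x a s => if p x a then Data.cons a s else s) hl (.const .nil)
    (by exact .ite hp' (by fun_prop) (by fun_prop)) ⟨.X + 1, fun x a s => ?_⟩).of_eq fun x => ?_
  · split_ifs <;> simp [Data.size]; omega
  · induction (l x).toList with
    | nil => rfl
    | cons a l ih =>
      by_cases h : p x a <;> simp [h, ih, ofList]

theorem map {f : Data → Data → Data} {l : Data → Data} (hl : PolyTime l)
    (hf : PolyTime fun y => f y.head y.tail) :
    PolyTime fun x => ofList ((l x).toList.map (f x)) := by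
  obtain ⟨B, hB⟩ := hf.size_le
  have hf' : PolyTime fun y => f y.head y.tail.head :=
    hf.comp (f := fun y => .cons y.head y.tail.head) (by fun_prop)
  refine (foldr (f := fun x a s => Data.cons (f x a) s) hl (.const .nil)
    (hf'.cons (by fun_prop)) ⟨B.comp (.X + 1) + 1, fun x a s => ?_⟩).of_eq fun x => ?_
  · have := hB (Data.cons x a)
    simp only [head_cons, tail_cons, Data.size] at this
    simp only [Data.size, Polynomial.eval_add, Polynomial.eval_comp, Polynomial.eval_X,
      Polynomial.eval_one]
    omega
  · induction (l x).toList with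
    | nil => rfl
    | cons a l ih => simp [ih, ofList]

end PolyTime

@[fun_prop]
theorem PolyDec.mem {a l : Data → Data} (ha : PolyTime a) (hl : PolyTime l) :
    PolyDec fun x => a x ∈ (l x).toList := by
  classical
  refine (PolyTime.foldr (f := fun x e s => if e = a x then .cons .nil .nil else s) hl
    (.const .nil) (by fun_prop) ⟨3, fun x e s => ?_⟩).of_eq fun x => ?_
  · split_ifs <;> simp [Data.size]
  · beta_reduce
    induction (l x).toList with
    | nil => simp [ofProp]
    | cons b l ih =>
      by_cases h : b = a x
      · simp [h, ofProp]
      · simp only [List.foldr_cons, h, if_false, ih, List.mem_cons, Ne.symm h, false_or]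

/-! ### Unary arithmetic -/

theorem ofNat_injective : Function.Injective ofNat := by
  intro m n h
  induction m generalizing n with
  | zero => cases n <;> simp [ofNat] at h ⊢
  | succ m ih =>
    cases n with
    | zero => simp [ofNat] at h
    | succ n => simp only [ofNat, cons.injEq, true_and] at h; rw [ih h]

@[simp] theorem ofNat_inj {m n : ℕ} : ofNat m = ofNat n ↔ m = n := ofNat_injective.eq_iff

@[simp] theorem size_ofNat (n : ℕ) : (ofNat n).size = 2 * n + 1 := by
  induction n with
  | zero => rfl
  | succ n ih => simp [ofNat, Data.size, ih]; omega

/-- The function `a` on natural numbers in unary is computable in polynomial time. -/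
def NatPolyTime (a : ℕ → ℕ) : Prop :=
  ∃ f : Data → Data, PolyTime f ∧ ∀ n, f (ofNat n) = ofNat (a n)

namespace NatPolyTime

theorem bounded {a : ℕ → ℕ} (ha : NatPolyTime a) : ∃ B : Polynomial ℕ, ∀ n, a n ≤ B.eval n := by
  obtain ⟨f, hf, hfa⟩ := ha
  obtain ⟨B, hB⟩ := hf.size_le
  refine ⟨B.comp (2 * .X + 1), fun n => ?_⟩
  have := hB (ofNat n)
  simp only [hfa, size_ofNat] at this
  simp only [Polynomial.eval_comp, Polynomial.eval_add, Polynomial.eval_mul, Polynomial.eval_ofNat,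
    Polynomial.eval_X, Polynomial.eval_one]
  omega

theorem const (k : ℕ) : NatPolyTime fun _ => k := ⟨_, .const (ofNat k), fun _ => rfl⟩

theorem id : NatPolyTime fun n => n := ⟨_, .id, fun _ => rfl⟩

theorem succ {a : ℕ → ℕ} (ha : NatPolyTime a) : NatPolyTime fun n => a n + 1 := by
  obtain ⟨f, hf, hfa⟩ := ha
  exact ⟨_, (PolyTime.const .nil).cons hf, fun n => by simp [hfa, ofNat]⟩

theorem pred {a : ℕ → ℕ} (ha : NatPolyTime a) : NatPolyTime fun n => a n - 1 := by
  obtain ⟨f, hf, hfa⟩ := ha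
  refine ⟨_, hf.tail, fun n => ?_⟩
  rw [hfa]
  beta_reduce
  cases a n <;> rfl

theorem foldr_ofNat {α : Type*} (g : α → α) (n : ℕ) (s : α) :
    (ofNat n).toList.foldr (fun _ s => g s) s = g^[n] s := by
  induction n with
  | zero => rfl
  | succ n ih => simp only [ofNat, toList_cons, List.foldr_cons, ih, Function.iterate_succ_apply']

theorem add {a b : ℕ → ℕ} (ha : NatPolyTime a) (hb : NatPolyTime b) :
    NatPolyTime fun n => a n + b n := by
  obtain ⟨f, hf, hfa⟩ := ha
  obtain ⟨g, hg, hgb⟩ := hb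
  refine ⟨_, PolyTime.foldr (f := fun _ _ s => .cons .nil s) hf hg (by fun_prop)
    ⟨2, fun x a s => by simp [Data.size]; omega⟩, fun n => ?_⟩
  simp only [foldr_ofNat (fun s => Data.cons .nil s), hfa, hgb]
  induction a n with
  | zero => simp
  | succ k ih => rw [Function.iterate_succ_apply', ih, Nat.succ_add]; rfl

theorem mul {a b : ℕ → ℕ} (ha : NatPolyTime a) (hb : NatPolyTime b) :
    NatPolyTime fun n => a n * b n := by
  obtain ⟨f, hf, hfa⟩ := ha
  obtain ⟨g, hg, hgb⟩ := hb
  obtain ⟨B, hB⟩ := hg.size_le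
  have hsize : ∀ u s : Data,
      (u.toList.foldr (fun _ s => Data.cons .nil s) s).size ≤ s.size + 2 * u.size := by
    intro u s
    induction u with
    | nil => simp
    | cons a l _ ih => simp [Data.size] at ih ⊢; omega
  have hadd : PolyTime fun y => (g y.head).toList.foldr (fun _ s => Data.cons .nil s) y.tail.tail :=
    PolyTime.foldr (f := fun _ _ s => .cons .nil s) (by fun_prop) (by fun_prop) (by fun_prop)
    ⟨2, fun x a s => by simp [Data.size]; omega⟩
  refine ⟨_, PolyTime.foldr
    (f := fun x _ s => (g x).toList.foldr (fun _ s => Data.cons .nil s) s) hf (.const .nil) hadd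
    ⟨2 * B, fun x e s => ?_⟩, fun n => ?_⟩
  · have h₁ := hsize (g x) s
    have h₂ := hB x
    have h₃ := eval_mono B (show x.size ≤ x.size + e.size by omega)
    simp only [Polynomial.eval_mul, Polynomial.eval_ofNat]
    omega
  · have h₁ : ∀ k m : ℕ,
        (ofNat k).toList.foldr (fun _ s => Data.cons .nil s) (ofNat m) = ofNat (k + m) := by
      intro k m
      induction k with
      | zero => simp [ofNat]
      | succ k ih => simp only [ofNat, toList_cons, List.foldr_cons, ih, Nat.succ_add]
    rw [hfa, hgb]
    beta_reduce
    induction a n with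
    | zero => simp [ofNat]
    | succ k ih =>
      simp only [ofNat, toList_cons, List.foldr_cons, ih, h₁]
      congr 1
      ring

theorem pow {a : ℕ → ℕ} (ha : NatPolyTime a) (d : ℕ) : NatPolyTime fun n => a n ^ d := by
  induction d with
  | zero => simpa using const 1
  | succ d ih => simpa only [pow_succ] using ih.mul ha

theorem div {a : ℕ → ℕ} (ha : NatPolyTime a) (b : ℕ) : NatPolyTime fun n => a n / b := by
  obtain ⟨f, hf, hfa⟩ := ha
  rcases Nat.eq_zero_or_pos b with rfl | hb
  · simpa using const 0
  classical
  -- `g` turns the pair of remainder and quotient of `k` into that of `k + 1`, with a carry when the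
  -- remainder would reach the constant `b`.
  let g : Data → Data := fun s => if Data.cons .nil s.head = ofNat b
    then Data.cons .nil (Data.cons .nil s.tail) else Data.cons (Data.cons .nil s.head) s.tail
  have hg : PolyTime g := by
    unfold g
    fun_prop
  have hsize : ∀ s : Data, (g s).size ≤ s.size + 6 := by
    intro s
    unfold g
    rcases s with _ | ⟨r, q⟩ <;> split_ifs <;> simp [Data.size, Data.head, Data.tail]
    all_goals omega
  have := PolyTime.foldr (f := fun _ _ s => g s) hf (.const (.cons .nil .nil)) (by fun_prop)
    ⟨6, fun x a s => by simpa using hsize s⟩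
  refine ⟨_, this.tail, fun n => ?_⟩
  simp only [foldr_ofNat g, hfa]
  have key : ∀ k, g^[k] (.cons .nil .nil) = .cons (ofNat (k % b)) (ofNat (k / b)) := by
    intro k
    induction k with
    | zero => simp [ofNat]
    | succ k ih =>
      rw [Function.iterate_succ_apply', ih]
      have hs : Data.cons .nil (ofNat (k % b)) = ofNat (k % b + 1) := rfl
      have hk := Nat.mod_lt k hb
      have hd := Nat.mod_add_div k b
      simp only [g, head_cons, tail_cons, hs, ofNat_inj]
      clear ih hs
      generalize k % b = r at *
      generalize k / b = q at *
      split_ifs with h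
      · have h₁ : k + 1 = b * (q + 1) := by rw [Nat.mul_succ]; omega
        rw [h₁, Nat.mul_mod_right, Nat.mul_div_cancel_left _ hb]; rfl
      · have h₁ : k + 1 = r + 1 + b * q := by omega
        rw [h₁, Nat.add_mul_mod_self_left, Nat.add_mul_div_left _ _ hb,
          Nat.mod_eq_of_lt (by omega), Nat.div_eq_of_lt (by omega), Nat.zero_add]
  rw [key]; rfl

/-- Finitely many exceptional values are hard-wired into the program, one equality test for each. -/
theorem of_eventually_eq {a a' : ℕ → ℕ} (ha : NatPolyTime a) (k : ℕ)
    (h : ∀ n, k ≤ n → a' n = a n) : NatPolyTime a' := by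
  classical
  induction k generalizing a with
  | zero => exact (funext fun n => h n (Nat.zero_le n) : a' = a) ▸ ha
  | succ k ih =>
    obtain ⟨f, hf, hfa⟩ := ha
    refine ih (a := fun n => if n = k then a' k else a n)
      ⟨fun x => if x = ofNat k then ofNat (a' k) else f x, by fun_prop, fun n => ?_⟩ fun n hn => ?_
    · by_cases hnk : n = k <;> simp [hnk, hfa]
    · by_cases hnk : n = k
      · simp [hnk]
      · simp [hnk, h n (by omega)]

end NatPolyTime

/-! ### Rational approximation of polynomials by polynomial-time functions -/

theorem exists_nat_div_btwn {x y : ℝ} (hx : 0 ≤ x) (hxy : x < y) :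
    ∃ a b : ℕ, 0 < b ∧ x < (a : ℝ) / b ∧ (a : ℝ) / b < y := by
  obtain ⟨r, h₁, h₂⟩ := exists_rat_btwn hxy
  have hr : (0 : ℚ) < r := by exact_mod_cast hx.trans_lt h₁
  have hr' : (r : ℝ) = (r.num.toNat : ℝ) / r.den := by
    have h : ((r.num.toNat : ℤ) : ℝ) = r.num := by
      rw [Int.toNat_of_nonneg (Rat.num_nonneg.2 hr.le)]
    rw [← Int.cast_natCast, h]
    exact_mod_cast (Rat.num_div_den r).symm
  exact ⟨r.num.toNat, r.den, r.den_pos, hr' ▸ h₁, hr' ▸ h₂⟩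

open Filter Topology in
-- The coefficients of `p` may be uncomputable, but `p n / n ^ d` with `d` the degree tends to the
-- leading coefficient. A single rational slightly above that coefficient therefore works for all
-- large `n`, and the remaining `n` are covered by a finite table. The denominator is eventually
-- constant, so the quotient is computable too.
theorem exists_natPolyTime_approx (p : Polynomial ℝ) (hp : ∀ n : ℕ, 0 ≤ p.eval (n : ℝ)) :
    ∃ a b : ℕ → ℕ, NatPolyTime a ∧ NatPolyTime b ∧ NatPolyTime (fun n => (a n - 1) / b n) ∧
      ∀ n, 0 < b n ∧ p.eval (n : ℝ) ≤ (a n : ℝ) / b n ∧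
        (a n : ℝ) / b n ≤ 4 / 3 * p.eval (n : ℝ) := by
  have hpt : ∀ n : ℕ, ∃ a b : ℕ, 0 < b ∧ p.eval (n : ℝ) ≤ (a : ℝ) / b ∧
      (a : ℝ) / b ≤ 4 / 3 * p.eval (n : ℝ) := by
    intro n
    rcases (hp n).eq_or_lt with h | h
    · exact ⟨0, 1, one_pos, by simp [← h], by simp [← h]⟩
    · obtain ⟨a, b, hb, h₁, h₂⟩ := exists_nat_div_btwn h.le
        (show p.eval (n : ℝ) < 4 / 3 * p.eval (n : ℝ) by linarith)
      exact ⟨a, b, hb, h₁.le, h₂.le⟩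
  choose a₀ b₀ hb₀ hlo hhi using hpt
  have hev : ∃ A b N : ℕ, 0 < b ∧ ∀ n : ℕ, N ≤ n →
      p.eval (n : ℝ) ≤ ((A * n ^ p.natDegree : ℕ) : ℝ) / b ∧
        ((A * n ^ p.natDegree : ℕ) : ℝ) / b ≤ 4 / 3 * p.eval (n : ℝ) := by
    rcases eq_or_ne p 0 with rfl | hp0
    · exact ⟨0, 1, 0, one_pos, by simp⟩
    have hlim : Tendsto (fun n : ℕ => p.eval (n : ℝ) / (n : ℝ) ^ p.natDegree) atTop
        (𝓝 p.leadingCoeff) := by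
      have := Polynomial.div_tendsto_atTop_leadingCoeff_div_of_degree_eq p
        (Polynomial.X ^ p.natDegree : Polynomial ℝ)
        (by rw [Polynomial.degree_X_pow, Polynomial.degree_eq_natDegree hp0])
      simp only [Polynomial.eval_pow, Polynomial.eval_X, Polynomial.leadingCoeff_X_pow,
        div_one] at this
      exact this.comp tendsto_natCast_atTop_atTop
    have hc : 0 < p.leadingCoeff := lt_of_le_of_ne
      (ge_of_tendsto' hlim fun n => div_nonneg (hp n) (by positivity))
      (Polynomial.leadingCoeff_ne_zero.2 hp0).symm
    obtain ⟨A, b, hb, h₁, h₂⟩ := exists_nat_div_btwn hc.le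
      (show p.leadingCoeff < 4 / 3 * p.leadingCoeff by linarith)
    obtain ⟨N, hN⟩ := eventually_atTop.1 ((hlim.eventually_lt_const h₁).and
      (hlim.eventually_const_lt (show 3 / 4 * ((A : ℝ) / b) < p.leadingCoeff by linarith)))
    refine ⟨A, b, N + 1, hb, fun n hn => ?_⟩
    obtain ⟨h₃, h₄⟩ := hN n (by omega)
    have hn0 : (0 : ℝ) < (n : ℝ) ^ p.natDegree :=
      pow_pos (by exact_mod_cast (by omega : 0 < n)) _
    rw [div_lt_iff₀ hn0] at h₃
    rw [lt_div_iff₀ hn0] at h₄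
    have h₅ : ((A * n ^ p.natDegree : ℕ) : ℝ) / b = (A : ℝ) / b * (n : ℝ) ^ p.natDegree := by
      push_cast; ring
    rw [h₅]
    constructor <;> linarith
  obtain ⟨A, b, N, hb, hN⟩ := hev
  have hA : NatPolyTime fun n => A * n ^ p.natDegree := (NatPolyTime.const A).mul (.pow .id _)
  refine ⟨fun n => if n < N then a₀ n else A * n ^ p.natDegree, fun n => if n < N then b₀ n else b,
    hA.of_eventually_eq N fun n hn => by simp [hn.not_gt],
    (NatPolyTime.const b).of_eventually_eq N fun n hn => by simp [hn.not_gt],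
    (hA.pred.div b).of_eventually_eq N fun n hn => by simp [hn.not_gt], fun n => ?_⟩
  by_cases hn : n < N
  · simpa [hn] using ⟨hb₀ n, hlo n, hhi n⟩
  · simpa only [hn, if_false] using ⟨hb, hN n (not_lt.1 hn)⟩

theorem div_le_pred_div_add_one {a b : ℕ} (hb : 0 < b) :
    (a : ℝ) / b ≤ (((a - 1) / b : ℕ) : ℝ) + 1 := by
  rw [div_le_iff₀ (by exact_mod_cast hb)]
  have := Nat.lt_div_mul_add (a := a - 1) hb
  have h : a ≤ ((a - 1) / b + 1) * b := by rw [Nat.succ_mul]; omega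
  exact_mod_cast h

theorem pred_div_le_div {a b : ℕ} : (((a - 1) / b : ℕ) : ℝ) ≤ (a : ℝ) / b :=
  Nat.cast_div_le.trans (div_le_div_of_nonneg_right (by exact_mod_cast Nat.sub_le a 1)
    (Nat.cast_nonneg b))

/-! ### Induced subgraphs -/

namespace FinGraph

theorem ext' {G H : FinGraph} (hv : G.verts = H.verts) (ha : ∀ u v, G.Adj u v ↔ H.Adj u v) :
    G = H := by
  cases G; cases H
  obtain rfl : _ = _ := hv
  obtain rfl : _ = _ := funext fun u => funext fun v => propext (ha u v)
  rfl

theorem mem_verts_right (G : FinGraph) {u v : ℕ} (h : G.Adj u v) : v ∈ G.verts :=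
  G.mem_verts v u (G.symm u v h)

/-- The subgraph induced by the vertices in `U`. -/
def induce (G : FinGraph) (U : Finset ℕ) : FinGraph := G.deleteVerts (G.verts \ U)

theorem mem_induce_verts {G : FinGraph} {U : Finset ℕ} {v : ℕ} :
    v ∈ (G.induce U).verts ↔ v ∈ G.verts ∧ v ∈ U := by
  simp [induce, deleteVerts]

theorem induce_verts {G : FinGraph} {U : Finset ℕ} (h : U ⊆ G.verts) :
    (G.induce U).verts = U := by
  ext v
  rw [mem_induce_verts]
  exact ⟨fun h => h.2, fun hv => ⟨h hv, hv⟩⟩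

theorem induce_adj {G : FinGraph} {U : Finset ℕ} {u v : ℕ} :
    (G.induce U).Adj u v ↔ G.Adj u v ∧ u ∈ U ∧ v ∈ U := by
  simp only [induce, deleteVerts, Finset.mem_sdiff, not_and, not_not]
  exact ⟨fun h => ⟨h.1, h.2.1 (G.mem_verts u v h.1), h.2.2 (G.mem_verts_right h.1)⟩,
    fun h => ⟨h.1, fun _ => h.2.1, fun _ => h.2.2⟩⟩

theorem induce_self (G : FinGraph) : G.induce G.verts = G := by
  refine ext' (induce_verts subset_rfl) fun u v => ?_
  rw [induce_adj]
  exact ⟨fun h => h.1, fun h => ⟨h, G.mem_verts u v h, G.mem_verts_right h⟩⟩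

theorem deleteVerts_induce_union {G : FinGraph} {U X : Finset ℕ} (hU : U ⊆ G.verts)
    (hX : X ⊆ G.verts) (h : Disjoint X U) : (G.induce (X ∪ U)).deleteVerts X = G.induce U := by
  refine ext' ?_ fun u v => ?_
  · change (G.induce (X ∪ U)).verts \ X = _
    rw [induce_verts (Finset.union_subset hX hU), induce_verts hU, Finset.union_sdiff_left,
      Finset.sdiff_eq_self_of_disjoint h.symm]
  · change (G.induce (X ∪ U)).Adj u v ∧ u ∉ X ∧ v ∉ X ↔ _
    rw [induce_adj, induce_adj, Finset.mem_union, Finset.mem_union]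
    have := @(Finset.disjoint_right.1 h)
    grind

/-- There are no edges between `U` and `W`. -/
def NonAdj (G : FinGraph) (U W : Finset ℕ) : Prop := ∀ u ∈ U, ∀ w ∈ W, ¬ G.Adj u w

theorem NonAdj.symm {G : FinGraph} {U W : Finset ℕ} (h : G.NonAdj U W) : G.NonAdj W U :=
  fun u hu w hw hadj => h w hw u hu (G.symm u w hadj)

theorem isDisjointUnion_induce {G : FinGraph} {U W : Finset ℕ} (hU : U ⊆ G.verts)
    (hW : W ⊆ G.verts) (hd : Disjoint U W) (hn : G.NonAdj U W) :
    (G.induce (U ∪ W)).IsDisjointUnion (G.induce U) (G.induce W) := by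
  refine ⟨by rwa [induce_verts hU, induce_verts hW], by
    rw [induce_verts hU, induce_verts hW, induce_verts (Finset.union_subset hU hW)], ?_⟩
  intro u v
  simp only [induce_adj, Finset.mem_union]
  have h₁ := hn u
  have h₂ := hn.symm u
  grind

end FinGraph

/-! ### Every graph has a code -/

theorem exists_graphCode (G : FinGraph) : ∃ d, IsGraphCode d G := by
  classical
  refine ⟨_, G.verts.toList, ((G.verts ×ˢ G.verts).filter fun e => G.Adj e.1 e.2).toList, rfl,
    by simp, fun u v => ?_⟩
  simp only [Finset.mem_toList, Finset.mem_filter, Finset.mem_product]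
  have h₁ := G.mem_verts u v
  have h₂ := G.mem_verts v u
  have h₃ := G.symm u v
  have h₄ := G.symm v u
  tauto

/-- A single bag suffices. Thereby the approximation algorithm applies to every graph and yields
information about optima, such as finiteness. -/
theorem exists_instanceCode (G : FinGraph) {ℓ : ℕ} (h : G.verts.card ≤ ℓ + 1) :
    ∃ d, IsInstanceCode d G ℓ := by
  obtain ⟨g, hg⟩ := exists_graphCode G
  let 𝒯 : TreeDecomposition G :=
    { n := 1
      tree := ⊥
      isTree := ⟨.of_subsingleton, .of_subsingleton⟩
      bag := fun _ => G.verts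
      mem_verts_iff := fun v => ⟨fun hv => ⟨0, hv⟩, fun ⟨_, hv⟩ => hv⟩
      exists_bag := fun u v huv => ⟨0, G.mem_verts u v huv, G.mem_verts_right huv⟩
      connected := fun v hv => by
        have : Nonempty {t : Fin 1 | v ∈ G.verts} := ⟨⟨0, hv⟩⟩
        exact .of_subsingleton }
  refine ⟨_, g, _, 𝒯, rfl, hg, ⟨fun _ => 0, fun _ => G.verts.toList, rfl, by simp [𝒯], ?_⟩,
    fun _ => h⟩
  intro i j
  obtain rfl : i = j := Fin.ext (by have := i.2; have := j.2; simp only [𝒯] at *; omega)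
  simp

/-! ### Optima and solution values as real numbers -/

namespace GraphProblem

variable {P : GraphProblem}

/-- The optimum as a real number. -/
noncomputable def optR (P : GraphProblem) (G : FinGraph) : ℝ := (P.opt G).toReal

/-- The value of a solution as a real number. -/
noncomputable def valR (P : GraphProblem) (G : FinGraph) (s : Data) : ℝ := (P.val G s).toReal

/-- `s` is a solution for `G` whose value has the ratio `β` to the optimum, up to an additive
error `e`. -/
def NearOpt (P : GraphProblem) (β e : ℝ) (G : FinGraph) (s : Data) : Prop :=
  P.IsSolution G s ∧
    match P.goal with
    | .minimize => P.valR G s ≤ β * P.optR G + e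
    | .maximize => P.optR G ≤ β * P.valR G s + e

theorem opt_le_val (h : P.goal = .minimize) (G : FinGraph) (s : Data) :
    P.opt G ≤ P.val G s := by
  simp only [opt, h, Goal.best]
  exact iInf_le _ s

theorem val_le_opt (h : P.goal = .maximize) (G : FinGraph) (s : Data) :
    P.val G s ≤ P.opt G := by
  simp only [opt, h, Goal.best]
  exact le_iSup _ s

namespace IsFriendly

variable {f : ℕ → ℝ} {h : ℝ → ℕ → ℕ} {φ : ℝ → ℕ → ℝ}

/-- Deleting all vertices does not increase the optimum and leaves the empty graph, whose optimum is
`0`. -/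
theorem opt_nonneg (hP : P.IsFriendly f h φ) (G : FinGraph) : 0 ≤ P.opt G := by
  have h₁ := hP.loss.le_opt G G.verts subset_rfl
  rwa [hP.additive.opt_empty _ (by simp [FinGraph.deleteVerts])] at h₁

theorem exists_opt_eq (hP : P.IsFriendly f h φ) (G : FinGraph) : ∃ r : ℝ, P.opt G = r := by
  obtain ⟨A, T, hA⟩ := hP.approx
  obtain ⟨d, hd⟩ := exists_instanceCode G (Nat.le_succ _)
  obtain ⟨s, -, -, hs⟩ := hA d G _ hd
  cases hg : P.goal <;> simp only [hg] at hs
  · obtain ⟨r, hr, -⟩ := hs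
    exact ⟨r, hr⟩
  · obtain ⟨r, -, hr⟩ := hs
    refine ⟨_, (EReal.coe_toReal (ne_top_of_le_ne_top (EReal.coe_ne_top _) hr) ?_).symm⟩
    exact (bot_lt_iff_ne_bot.1 (EReal.bot_lt_zero.trans_le (hP.opt_nonneg G)))

theorem coe_optR (hP : P.IsFriendly f h φ) (G : FinGraph) : (P.optR G : EReal) = P.opt G := by
  obtain ⟨r, hr⟩ := hP.exists_opt_eq G
  rw [optR, hr, EReal.toReal_coe]

theorem optR_nonneg (hP : P.IsFriendly f h φ) (G : FinGraph) : 0 ≤ P.optR G := by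
  have := hP.opt_nonneg G
  rw [← hP.coe_optR] at this
  exact_mod_cast this

/-- Feasibility excludes one infinite value; comparison with the finite optimum excludes the other.
-/
theorem coe_valR (hP : P.IsFriendly f h φ) {G : FinGraph} {s : Data} (hs : P.IsSolution G s) :
    (P.valR G s : EReal) = P.val G s := by
  unfold IsSolution at hs
  cases hg : P.goal <;> simp only [hg, Goal.infeasible] at hs
  · refine EReal.coe_toReal hs (bot_lt_iff_ne_bot.1 (EReal.bot_lt_zero.trans_le ?_))
    exact (hP.opt_nonneg G).trans (opt_le_val hg G s)
  · refine EReal.coe_toReal (ne_top_of_le_ne_top ?_ (val_le_opt hg G s)) hs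
    rw [← hP.coe_optR]
    exact EReal.coe_ne_top _

theorem optR_le_valR (hP : P.IsFriendly f h φ) (hg : P.goal = .minimize) {G : FinGraph} {s : Data}
    (hs : P.IsSolution G s) : P.optR G ≤ P.valR G s := by
  have := opt_le_val hg G s
  rw [← hP.coe_optR, ← hP.coe_valR hs] at this
  exact_mod_cast this

theorem valR_le_optR (hP : P.IsFriendly f h φ) (hg : P.goal = .maximize) {G : FinGraph} {s : Data}
    (hs : P.IsSolution G s) : P.valR G s ≤ P.optR G := by
  have := val_le_opt hg G s
  rw [← hP.coe_optR, ← hP.coe_valR hs] at this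
  exact_mod_cast this

theorem optR_empty (hP : P.IsFriendly f h φ) {G : FinGraph} (hG : G.verts = ∅) : P.optR G = 0 := by
  rw [optR, hP.additive.opt_empty G hG, EReal.toReal_zero]

theorem optR_union (hP : P.IsFriendly f h φ) {G G₁ G₂ : FinGraph}
    (hG : G.IsDisjointUnion G₁ G₂) : P.optR G = P.optR G₁ + P.optR G₂ := by
  have := hP.additive.opt_union G G₁ G₂ hG
  rw [← hP.coe_optR, ← hP.coe_optR, ← hP.coe_optR] at this
  exact_mod_cast this

theorem optR_delete_le (hP : P.IsFriendly f h φ) {G : FinGraph} {X : Finset ℕ}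
    (hX : X ⊆ G.verts) : P.optR (G.deleteVerts X) ≤ P.optR G := by
  have := hP.loss.le_opt G X hX
  rw [← hP.coe_optR, ← hP.coe_optR] at this
  exact_mod_cast this

theorem optR_induce_le (hP : P.IsFriendly f h φ) (G : FinGraph) (U : Finset ℕ) :
    P.optR (G.induce U) ≤ P.optR G :=
  hP.optR_delete_le Finset.sdiff_subset

theorem optR_le_delete_add (hP : P.IsFriendly f h φ) {G : FinGraph} {X : Finset ℕ}
    (hX : X ⊆ G.verts) : P.optR G ≤ P.optR (G.deleteVerts X) + f X.card := by
  have := hP.loss.opt_le G X hX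
  rw [← hP.coe_optR, ← hP.coe_optR] at this
  exact_mod_cast this

theorem f_nonneg (hP : P.IsFriendly f h φ) (n : ℕ) : 0 ≤ f n := by
  have := hP.optR_le_delete_add (G := ⟨∅, fun _ _ => False, by simp, by simp, by simp⟩)
    (X := ∅) (by simp)
  rw [hP.optR_empty rfl, hP.optR_empty rfl] at this
  exact (by simpa using this : 0 ≤ f 0).trans (hP.f_mono n.zero_le)

theorem isApproxSolution_iff (hP : P.IsFriendly f h φ) {β : ℝ} {G : FinGraph} {s : Data} :
    P.IsApproxSolution β G s ↔ P.NearOpt β 0 G s := by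
  unfold IsApproxSolution NearOpt
  refine and_congr_right fun hs => ?_
  rw [← hP.coe_valR hs, ← hP.coe_optR]
  cases P.goal <;> simp only [Goal.Within, add_zero] <;> norm_cast

/-- Friendliness does not list this property; it follows by running the approximation algorithm on
the empty graph. -/
theorem φ_zero_nonneg (hP : P.IsFriendly f h φ) (ℓ : ℕ) : 0 ≤ φ 0 ℓ := by
  let G : FinGraph := ⟨∅, fun _ _ => False, by simp, by simp, by simp⟩
  obtain ⟨A, T, hA⟩ := hP.approx
  obtain ⟨d, hd⟩ := exists_instanceCode G (show G.verts.card ≤ ℓ + 1 by simp [G])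
  obtain ⟨s, -, hs, hr⟩ := hA d G _ hd
  have h0 : P.optR G = 0 := hP.optR_empty rfl
  cases hg : P.goal <;> simp only [hg] at hr
  · obtain ⟨r, hr, h₁⟩ := hr
    rw [← hP.coe_valR hs] at h₁
    rw [← hP.coe_optR, h0] at hr
    obtain rfl : 0 = r := by exact_mod_cast hr
    have h₂ := hP.optR_le_valR hg hs
    rw [h0] at h₂
    exact h₂.trans (by exact_mod_cast h₁)
  · obtain ⟨r, hr, h₁⟩ := hr
    have h₂ := hP.valR_le_optR hg hs
    rw [h0] at h₂
    rw [← hP.coe_valR hs] at hr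
    rw [← hP.coe_optR, h0] at h₁
    have hr' : P.valR G s = r := by exact_mod_cast hr
    exact (by exact_mod_cast h₁ : 0 ≤ φ r ℓ).trans (hP.φ_mono ℓ (hr' ▸ h₂))

theorem φ_nonneg (hP : P.IsFriendly f h φ) {k : ℝ} (hk : 0 ≤ k) (ℓ : ℕ) : 0 ≤ φ k ℓ :=
  (hP.φ_zero_nonneg ℓ).trans (hP.φ_mono ℓ hk)

/-! ### Thresholds -/

theorem exists_polynomial_φ (hP : P.IsFriendly f h φ) (α : ℝ) :
    ∃ p : Polynomial ℝ, ∀ ℓ : ℕ, φ (α * f (ℓ + 1)) ℓ = p.eval (ℓ : ℝ) := by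
  obtain ⟨pf, hf⟩ := hP.f_polynomial
  obtain ⟨q, hq⟩ := hP.φ_polynomial
  refine ⟨MvPolynomial.aeval ![Polynomial.C α * pf.comp (.X + 1), .X] q, fun ℓ => ?_⟩
  rw [hq, hf]
  clear hq
  induction q using MvPolynomial.induction_on with
  | C a => simp
  | add p q hp hq => simp only [map_add, Polynomial.eval_add, hp, hq]
  | mul_X p i hp =>
    simp only [map_mul, hp, Polynomial.eval_mul, MvPolynomial.eval_X, MvPolynomial.aeval_X]
    congr 1
    fin_cases i <;> simp

/-- Computable thresholds: a solution of value more than `a ℓ / b ℓ` found by the approximation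
algorithm certifies a large optimum, and one of smaller value certifies that the optimum is at most
`M ℓ + 1`. -/
theorem exists_thresholds (hP : P.IsFriendly f h φ) {ε : ℝ} (hε : 0 < ε) :
    ∃ a b M : ℕ → ℕ, NatPolyTime a ∧ NatPolyTime b ∧ NatPolyTime M ∧ ∀ ℓ, 0 < b ℓ ∧
      (M ℓ : ℝ) ≤ φ (6 * f (ℓ + 1) / ε + f 1) ℓ ∧
      match P.goal with
      | .minimize => φ (3 * f (ℓ + 1) / ε) ℓ ≤ (a ℓ : ℝ) / b ℓ ∧ (a ℓ : ℝ) / b ℓ ≤ M ℓ + 1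
      | .maximize => 3 * f (ℓ + 1) / ε ≤ (a ℓ : ℝ) / b ℓ ∧ φ ((a ℓ : ℝ) / b ℓ) ℓ ≤ M ℓ + 1 := by
  have hk : ∀ (x : ℝ) ℓ, 0 ≤ x → 0 ≤ x * f (ℓ + 1) := fun x ℓ hx =>
    mul_nonneg hx (hP.f_nonneg _)
  -- The factor `4 / 3` lost by rational approximation is moved inside `φ` with `φ_mul_le`. It is
  -- applied with `x = 3 / ε` and `x = 4 / ε`, where `4 / 3 * x` is `4 / ε` and `16 / (3 * ε)`.
  have hfin : ∀ (x y : ℝ) ℓ, 0 ≤ x → 4 / 3 * x ≤ 6 / ε → y ≤ 4 / 3 * φ (x * f (ℓ + 1)) ℓ →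
      y ≤ φ (6 * f (ℓ + 1) / ε + f 1) ℓ := by
    intro x y ℓ hx hx' hy
    refine hy.trans ((hP.φ_mul_le _ _ ℓ (by norm_num) (hk x ℓ hx)).trans (hP.φ_mono ℓ ?_))
    have h₁ := mul_le_mul_of_nonneg_right hx' (hP.f_nonneg (ℓ + 1))
    have h₂ := hP.f_nonneg 1
    have h₃ : 6 / ε * f (ℓ + 1) = 6 * f (ℓ + 1) / ε := by ring
    linarith
  cases hg : P.goal
  · obtain ⟨p, hp⟩ := hP.exists_polynomial_φ (3 / ε)
    obtain ⟨a, b, ha, hb, hM, hab⟩ := exists_natPolyTime_approx p fun ℓ => by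
      rw [← hp]
      exact hP.φ_nonneg (hk _ _ (by positivity)) _
    refine ⟨a, b, _, ha, hb, hM, fun ℓ => ⟨(hab ℓ).1, ?_, ?_, div_le_pred_div_add_one (hab ℓ).1⟩⟩
    · refine pred_div_le_div.trans (hfin (3 / ε) _ ℓ (by positivity) ?_ ?_)
      · rw [← mul_div_assoc]
        gcongr
        norm_num
      · rw [hp]
        exact (hab ℓ).2.2
    · rw [mul_div_right_comm, hp]
      exact (hab ℓ).2.1
  -- Maximization rounds twice: the threshold goes from `3 f(ℓ+1)/ε` up to at most `4 f(ℓ+1)/ε`, and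
  -- then `φ` at the latter point is approximated to define `M`.
  · obtain ⟨pf, hf⟩ := hP.f_polynomial
    have hF : ∀ ℓ : ℕ, (Polynomial.C (3 / ε) * pf.comp (.X + 1)).eval (ℓ : ℝ) =
        3 / ε * f (ℓ + 1) := fun ℓ => by simp [hf]
    obtain ⟨a, b, ha, hb, -, hab⟩ := exists_natPolyTime_approx
      (Polynomial.C (3 / ε) * pf.comp (.X + 1)) fun ℓ => by
        rw [hF]
        exact hk _ _ (by positivity)
    obtain ⟨p, hp⟩ := hP.exists_polynomial_φ (4 / ε)
    obtain ⟨a', b', -, -, hM, hab'⟩ := exists_natPolyTime_approx p fun ℓ => by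
      rw [← hp]
      exact hP.φ_nonneg (hk _ _ (by positivity)) _
    refine ⟨a, b, _, ha, hb, hM, fun ℓ => ⟨(hab ℓ).1, ?_, ?_, ?_⟩⟩
    · refine pred_div_le_div.trans (hfin (4 / ε) _ ℓ (by positivity) ?_ ?_)
      · rw [← mul_div_assoc]
        gcongr
        norm_num
      · rw [hp]
        exact (hab' ℓ).2.2
    · rw [mul_div_right_comm, ← hF]
      exact (hab ℓ).2.1
    · refine le_trans (hP.φ_mono ℓ ?_) ((hp ℓ).le.trans
        ((hab' ℓ).2.1.trans (div_le_pred_div_add_one (hab' ℓ).1)))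
      refine (hab ℓ).2.2.trans (le_of_eq ?_)
      rw [hF]
      ring

end IsFriendly

end GraphProblem

/-! ### The solver: kernelization of parts with small optimum -/

theorem Alg.bind {g : Data → Data} {S₁ S₂ : Spec} (hg : PolyTime g) (h₁ : Alg S₁) (h₂ : Alg S₂) :
    Alg fun O Q x Φ => S₁ O Q (g x) fun y => S₂ O Q (cons x y) Φ :=
  Alg.comp (Alg.pair PolyTime.id (Alg.comp hg h₁)) h₂

namespace GraphProblem.IsFriendly

variable {P : GraphProblem} {f : ℕ → ℝ} {h : ℝ → ℕ → ℕ} {φ : ℝ → ℕ → ℝ}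

theorem optBot_eq (hP : P.IsFriendly f h φ) (G : FinGraph) (m : ℕ) :
    P.optBot G m = ((min (P.optR G) (m + 1) : ℝ) : EReal) := by
  have hne : Nonempty Data := ⟨.nil⟩
  rw [EReal.coe_strictMono.monotone.map_min, hP.coe_optR]
  cases hg : P.goal <;> simp only [optBot, opt, hg, Goal.best, valBot]
  · exact iInf_inf.symm
  · exact (iSup_inf_eq _ _).symm

theorem valBot_eq (hP : P.IsFriendly f h φ) {G : FinGraph} {s : Data} (hs : P.IsSolution G s)
    (m : ℕ) : P.valBot G m s = ((min (P.valR G s) (m + 1) : ℝ) : EReal) := by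
  rw [EReal.coe_strictMono.monotone.map_min, hP.coe_valR hs, valBot]

/-- Truncation preserves ratios `c ≥ 1` because `m + 1 ≤ c * (m + 1)`. This transfers the oracle's
guarantee for `P` to `P^⊥` on the kernel. -/
theorem within_bot (hP : P.IsFriendly f h φ) {G : FinGraph} {s : Data} {c : ℝ} (hc : 1 ≤ c)
    (hs : P.IsApproxSolution c G s) (m : ℕ) :
    P.goal.Within c (P.valBot G m s) (P.optBot G m) := by
  rw [hP.optBot_eq, hP.valBot_eq hs.1]
  obtain ⟨hs, h⟩ := hP.isApproxSolution_iff.1 hs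
  have hm : (0 : ℝ) < (m : ℝ) + 1 := by positivity
  have ho := hP.optR_nonneg G
  have hcm := le_mul_of_one_le_left hm.le hc
  have hmul := fun a b : ℝ => mul_min_of_nonneg a b (zero_le_one.trans hc)
  cases hg : P.goal <;> simp only [hg, add_zero] at h <;> simp only [Goal.Within] <;>
    rw [← EReal.coe_mul, EReal.coe_le_coe_iff, hmul]
  · exact min_le_min h hcm
  · exact min_le_min h hcm

theorem nearOpt_of_within_bot_min (hP : P.IsFriendly f h φ) (hg : P.goal = .minimize)
    {G : FinGraph} {t : Data} {m : ℕ} {α : ℝ} (hα : 0 ≤ α)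
    (ht : P.goal.Within α (P.valBot G m t) (P.optBot G m))
    (hv : P.val G t ≤ (((m : ℝ) + 1 : ℝ) : EReal)) : P.NearOpt α 0 G t := by
  have hs : P.IsSolution G t := by
    rw [IsSolution, hg]
    exact ne_top_of_le_ne_top (EReal.coe_ne_top _) hv
  rw [← hP.coe_valR hs, EReal.coe_le_coe_iff] at hv
  rw [hP.optBot_eq, hP.valBot_eq hs, hg, min_eq_left hv] at ht
  simp only [Goal.Within] at ht
  rw [← EReal.coe_mul, EReal.coe_le_coe_iff] at ht
  refine ⟨hs, ?_⟩
  simp only [hg, add_zero]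
  exact ht.trans (mul_le_mul_of_nonneg_left (min_le_left _ _) hα)

/-- If the lifted string `t` is truncated, its guarantee reads `m + 1 ≤ α * OPT`, so any solution
`s` of value at most `m + 1` is good enough. The solution of the approximation algorithm will serve
as this fallback. -/
theorem nearOpt_of_within_bot_min' (hP : P.IsFriendly f h φ) (hg : P.goal = .minimize)
    {G : FinGraph} {s t : Data} {m : ℕ} {α : ℝ} (hα : 0 ≤ α)
    (ht : P.goal.Within α (P.valBot G m t) (P.optBot G m))
    (hv : ¬ P.val G t ≤ (((m : ℝ) + 1 : ℝ) : EReal)) (hs : P.IsSolution G s)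
    (hsm : P.valR G s ≤ m + 1) : P.NearOpt α 0 G s := by
  rw [hP.optBot_eq, valBot, min_eq_right (not_le.1 hv).le, hg] at ht
  simp only [Goal.Within] at ht
  rw [← EReal.coe_mul, EReal.coe_le_coe_iff] at ht
  refine ⟨hs, ?_⟩
  simp only [hg, add_zero]
  exact hsm.trans (ht.trans (mul_le_mul_of_nonneg_left (min_le_left _ _) hα))

theorem nearOpt_of_within_bot_max (hP : P.IsFriendly f h φ) (hg : P.goal = .maximize)
    {G : FinGraph} {t : Data} {m : ℕ} {α : ℝ} (hα : 0 < α)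
    (ht : P.goal.Within α (P.valBot G m t) (P.optBot G m)) (ho : P.optR G ≤ m + 1) :
    P.NearOpt α 0 G t := by
  rw [hP.optBot_eq, min_eq_left ho, hg] at ht
  simp only [Goal.Within] at ht
  -- An infeasible `t` has value `⊥`, and `α * ⊥ = ⊥` for positive `α` cannot bound a real optimum.
  have hs : P.IsSolution G t := by
    rw [IsSolution, hg]
    intro hbot
    rw [valBot, hbot] at ht
    simp only [Goal.infeasible, bot_le, inf_of_le_left, EReal.coe_mul_bot_of_pos hα] at ht
    exact EReal.coe_ne_bot _ (le_bot_iff.1 ht)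
  rw [hP.valBot_eq hs, ← EReal.coe_mul, EReal.coe_le_coe_iff] at ht
  refine ⟨hs, ?_⟩
  simp only [hg, add_zero]
  exact ht.trans (mul_le_mul_of_nonneg_left (min_le_left _ _) hα.le)

/-- A polynomial-time oracle algorithm that finds a good solution or detects that the optimum is
large. -/
theorem exists_solver (hP : P.IsFriendly f h φ) {ε : ℝ} (hε : 0 < ε) :
    ∃ q : Polynomial ℕ, Alg fun O Q x Φ => ∃ (H : FinGraph) (ℓ : ℕ) (c : ℝ), 1 ≤ c ∧
      P.IsApproxOracle c O ∧ IsInstanceCode x H ℓ ∧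
      (∀ y G', IsGraphCode y G' →
        G'.verts.card ≤ h (ε / 3) (⌊φ (6 * f (ℓ + 1) / ε + f 1) ℓ⌋₊ + ℓ) →
        y.size ≤ q.eval ℓ → Q y) ∧
      (3 * f (ℓ + 1) / ε < P.optR H → Φ .nil) ∧
      (∀ s, P.NearOpt ((1 + ε / 3) * c) 0 H s → Φ (cons .nil s)) := by
  obtain ⟨a, b, M, ⟨fa, hfa, hfa'⟩, ⟨fb, hfb, hfb'⟩, hM, hthr⟩ := hP.exists_thresholds hε
  obtain ⟨fm, hfm, hfm'⟩ := hM.add .id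
  obtain ⟨Bm, hBm⟩ := (hM.add .id).bounded
  obtain ⟨A, T, hA⟩ := hP.approx
  obtain ⟨V, Tv, hV⟩ := P.val_polyTime
  obtain ⟨bs, hbs⟩ := P.size_le
  obtain ⟨R, L, Tk, q, hk⟩ := hP.kernel (ε / 3) (by positivity)
  have hAlgA := Alg.ofRunsIn A T
  have hAlgV := Alg.ofRunsIn V Tv
  have hAlgR := Alg.ofRunsIn R Tk
  have hAlgL := Alg.ofRunsIn L Tk
  let inst : Data → Data := fun d => cons d.head (cons d.tail.head (fm d.tail.tail))
  have hinst : PolyTime inst := by unfold inst; fun_prop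
  -- the contexts are `(d, s)`, `((d, s), r)`, `(((d, s), r), s')`, `((((d, s), r), s'), t)`
  have hg₁ : PolyTime fun x => cons x.head.head
      (cons x.tail (cons (fa x.head.tail.tail) (fb x.head.tail.tail))) := by fun_prop
  have hg₂ : PolyTime fun x => inst x.head := by fun_prop
  have hg₃ : PolyTime fun x => x.tail.head := by fun_prop
  have hg₄ : PolyTime fun x => cons (inst x.head.head.head) (cons x.head.tail x.tail) := by fun_prop
  have hg₅ : PolyTime fun x => cons x.head.head.head.head.head
      (cons x.tail (cons (cons .nil (fm x.head.head.head.head.tail.tail)) (ofNat 1))) := by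
    fun_prop
  have hout : PolyTime fun x => cons .nil x.tail := by fun_prop
  have hout' : PolyTime fun x => cons .nil x.head.head.head.tail := by fun_prop
  -- Only minimization has to choose at the end between the lifted solution and the fallback; the
  -- program may depend on the fixed goal.
  have hlast : ∃ S : Spec, Alg S ∧ ∀ O Q x Φ, S O Q x Φ ↔
      match P.goal with
      | .minimize => ∃ y, V.RunsIn Tv (cons x.head.head.head.head.head
          (cons x.tail (cons (cons .nil (fm x.head.head.head.head.tail.tail)) (ofNat 1)))) y ∧
          (y ≠ .nil → Φ (cons .nil x.tail)) ∧ (y = .nil → Φ (cons .nil x.head.head.head.tail))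
      | .maximize => Φ (cons .nil x.tail) := by
    cases P.goal
    · exact ⟨_, Alg.ite (Alg.comp hg₅ hAlgV) hout hout', fun O Q x Φ => Iff.rfl⟩
    · exact ⟨_, hout, fun O Q x Φ => Iff.rfl⟩
  obtain ⟨Slast, hlast, hSlast⟩ := hlast
  have halg := Alg.bind PolyTime.id hAlgA (Alg.ite (Alg.comp hg₁ hAlgV)
    (Alg.bind hg₂ hAlgR (Alg.bind hg₃ (Alg.query bs) (Alg.bind hg₄ hAlgL hlast)))
    (PolyTime.const .nil))
  refine ⟨q.comp Bm, halg.weaken ?_⟩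
  rintro O Q d Φ ⟨H, ℓ, c, hc, hO, hd, hQ, hheavy, hlight⟩
  obtain ⟨hb, hMφ, hthr⟩ := hthr ℓ
  obtain ⟨s, hAs, hs, hsφ⟩ := hA d H ℓ hd
  refine ⟨s, hAs, ?_⟩
  obtain ⟨g, τ, 𝒯, rfl, hg, hτ, hw⟩ := id hd
  simp only [head_cons, tail_cons, hfa', hfb', hfm', inst, hSlast]
  obtain ⟨y, hy, hyv⟩ := hV g H s (a ℓ) (b ℓ) hg hb
  refine ⟨y, hy, fun hyn => ?_, fun hyn => hheavy ?_⟩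
  swap
  -- A value above the threshold certifies heaviness. For minimization a small optimum would give a
  -- value of at most `φ (3 f(ℓ+1)/ε) ℓ`; for maximization the value itself is a lower bound for the
  -- optimum.
  · have hlt := not_le.1 (hyv.not.1 (not_not.2 hyn))
    rw [← hP.coe_valR hs, EReal.coe_lt_coe_iff] at hlt
    cases hgoal : P.goal <;> simp only [hgoal] at hsφ hthr
    · obtain ⟨r, hr, hval⟩ := hsφ
      rw [← hP.coe_valR hs, EReal.coe_le_coe_iff] at hval
      rw [← hP.coe_optR, EReal.coe_eq_coe_iff] at hr
      by_contra! hle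
      have := hP.φ_mono ℓ (hr ▸ hle)
      simp only at this
      linarith [hthr.1]
    · exact hthr.1.trans_lt (hlt.trans_le (hP.valR_le_optR hgoal hs))
  have hle := hyv.1 hyn
  rw [← hP.coe_valR hs, EReal.coe_le_coe_iff] at hle
  set m := M ℓ + ℓ with hm
  have hmR : (M ℓ : ℝ) ≤ m := by exact_mod_cast Nat.le_add_right _ _
  -- The kernel reads its parameter from the width entry, which is therefore raised to `M ℓ + ℓ`;
  -- the old decomposition still satisfies the weaker width bound.
  have hd' : IsInstanceCode (cons g (cons τ (ofNat m))) H m :=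
    ⟨g, τ, 𝒯, rfl, hg, hτ, fun t => (hw t).trans (by omega)⟩
  obtain ⟨g', G', m', hR, hg', hcard, hsize, -, hlift⟩ := hk _ H m hd'
  refine ⟨_, hR, ?_⟩
  simp only [head_cons]
  have hs' := hO g' G' hg'
  refine ⟨hQ g' G' hg' (hcard.trans (hP.h_mono _ (by positivity) ?_)) ?_,
    hbs g' G' _ hg' hs'.1, ?_⟩
  · exact Nat.add_le_add_right (Nat.le_floor hMφ) ℓ
  · rw [Polynomial.eval_comp]
    exact hsize.trans (eval_mono q (hBm ℓ))
  obtain ⟨t, hL, ht⟩ := hlift _ hs'.1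
  refine ⟨t, hL, ?_⟩
  have hα : 0 < (1 + ε / 3) * c := by positivity
  specialize ht c hc (hP.within_bot hc hs' m')
  cases hgoal : P.goal <;> simp only [hgoal] at hthr ⊢
  · obtain ⟨y, hy, hyv⟩ := hV g H t (m + 1) 1 hg one_pos
    have hcast : ((((m + 1 : ℕ) : ℝ) / ((1 : ℕ) : ℝ) : ℝ) : EReal) = (((m : ℝ) + 1 : ℝ) : EReal) := by
      simp
    rw [hcast] at hyv
    refine ⟨y, hy, fun hyn => hlight t ?_, fun hyn => hlight s ?_⟩
    · exact hP.nearOpt_of_within_bot_min hgoal hα.le ht (hyv.1 hyn)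
    · exact hP.nearOpt_of_within_bot_min' hgoal hα.le ht (hyv.not.1 (not_not.2 hyn)) hs
        (by linarith [hthr.2])
  · refine hlight t (hP.nearOpt_of_within_bot_max hgoal hα ht ?_)
    simp only [hgoal] at hsφ
    obtain ⟨r, hr, hopt⟩ := hsφ
    rw [← hP.coe_valR hs, EReal.coe_eq_coe_iff] at hr
    rw [← hP.coe_optR, EReal.coe_le_coe_iff] at hopt
    have := hP.φ_mono ℓ (hr ▸ hle)
    simp only at this
    linarith [hthr.2]

end GraphProblem.IsFriendly

/-! ### Rooted tree decompositions -/

/-- The nodes `0, …, n - 1` with parents `par` and bags `bag` form a tree decomposition of width at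
most `ℓ`, expressed by the edges that cross a separation of the nodes. -/
structure IsRootedDecomposition (G : FinGraph) (ℓ n : ℕ) (par : ℕ → ℕ) (bag : ℕ → Finset ℕ) :
    Prop where
  mem_verts_iff : ∀ v, v ∈ G.verts ↔ ∃ i < n, v ∈ bag i
  exists_bag : ∀ u v, G.Adj u v → ∃ i < n, u ∈ bag i ∧ v ∈ bag i
  card_le : ∀ i < n, (bag i).card ≤ ℓ + 1
  pos : 0 < n
  cross : ∀ (S : ℕ → Prop) (i j : ℕ), i < n → j < n → S i → ¬ S j →
    ∃ a b, a < n ∧ b < n ∧ S a ∧ ¬ S b ∧ (a < b ∧ par b = a ∨ b < a ∧ par a = b)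
  cross_bag : ∀ (v : ℕ) (S : ℕ → Prop) (i j : ℕ), i < n → j < n → v ∈ bag i → v ∈ bag j →
    S i → ¬ S j → ∃ a b, a < n ∧ b < n ∧ v ∈ bag a ∧ v ∈ bag b ∧ S a ∧ ¬ S b ∧
      (a < b ∧ par b = a ∨ b < a ∧ par a = b)

theorem exists_rootedDecomposition {d : Data} {G : FinGraph} {ℓ : ℕ} (hd : IsInstanceCode d G ℓ) :
    ∃ (g : Data) (n : ℕ) (par : ℕ → ℕ) (bags : ℕ → List ℕ),
      d = cons g (cons (ofList ((List.range n).map fun i =>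
        cons (ofNat (par i)) (ofNatList (bags i)))) (ofNat ℓ)) ∧
      IsGraphCode g G ∧ IsRootedDecomposition G ℓ n par fun i => (bags i).toFinset := by
  obtain ⟨g, τ, 𝒯, rfl, hg, ⟨par, bags, rfl, hbags, hadj⟩, hw⟩ := hd
  refine ⟨g, 𝒯.n, fun i => if h : i < 𝒯.n then par ⟨i, h⟩ else 0,
    fun i => if h : i < 𝒯.n then bags ⟨i, h⟩ else [], ?_, hg, ?_⟩
  · congr 3
    refine List.ext_getElem (by simp) fun i hi _ => ?_
    have hi' : i < 𝒯.n := by simpa using hi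
    simp [hi']
  have hbag : ∀ t : Fin 𝒯.n,
      (if h : (t : ℕ) < 𝒯.n then bags ⟨t, h⟩ else []).toFinset = 𝒯.bag t := fun t => by
    rw [dif_pos t.2, hbags]
  have hadj' : ∀ a b : Fin 𝒯.n, 𝒯.tree.Adj a b →
      ((a : ℕ) < b ∧ (if h : (b : ℕ) < 𝒯.n then par ⟨b, h⟩ else 0) = a ∨
        (b : ℕ) < a ∧ (if h : (a : ℕ) < 𝒯.n then par ⟨a, h⟩ else 0) = b) := fun a b hab => by
    rw [dif_pos a.2, dif_pos b.2]
    exact (hadj a b).1 hab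
  refine ⟨fun v => ?_, fun u v huv => ?_, fun i hi => ?_, ?_, ?_, ?_⟩
  · rw [𝒯.mem_verts_iff]
    exact ⟨fun ⟨t, ht⟩ => ⟨t, t.2, (hbag t).symm ▸ ht⟩, fun ⟨i, hi, h⟩ => ⟨⟨i, hi⟩, hbag ⟨i, hi⟩ ▸ h⟩⟩
  · obtain ⟨t, hu, hv⟩ := 𝒯.exists_bag u v huv
    exact ⟨t, t.2, (hbag t).symm ▸ hu, (hbag t).symm ▸ hv⟩
  · exact (hbag ⟨i, hi⟩) ▸ hw ⟨i, hi⟩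
  · exact Fin.pos_iff_nonempty.2 𝒯.isTree.1.nonempty
  · intro S i j hi hj hSi hSj
    obtain ⟨p⟩ := 𝒯.isTree.1.preconnected ⟨i, hi⟩ ⟨j, hj⟩
    obtain ⟨e, -, h₁, h₂⟩ := p.exists_boundary_dart {t | S t} hSi hSj
    exact ⟨e.fst, e.snd, e.fst.2, e.snd.2, h₁, h₂, hadj' _ _ e.adj⟩
  · intro v S i j hi hj hvi hvj hSi hSj
    have hvi' := (hbag ⟨i, hi⟩) ▸ hvi
    have hvj' := (hbag ⟨j, hj⟩) ▸ hvj
    have hv : v ∈ G.verts := (𝒯.mem_verts_iff v).2 ⟨_, hvi'⟩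
    obtain ⟨p⟩ := (𝒯.connected v hv).preconnected ⟨⟨i, hi⟩, hvi'⟩ ⟨⟨j, hj⟩, hvj'⟩
    obtain ⟨e, -, h₁, h₂⟩ := p.exists_boundary_dart {t | S t.1} hSi hSj
    have hb := fun t : {t | v ∈ 𝒯.bag t} => (hbag t.1).symm ▸ (show v ∈ 𝒯.bag t.1 from t.2)
    exact ⟨e.fst.1, e.snd.1, e.fst.1.2, e.snd.1.2, hb _, hb _, h₁, h₂, hadj' _ _ e.adj⟩

/-- `Desc par i j`: the node `j` is a descendant of the node `i`, or `i` itself. -/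
inductive Desc (par : ℕ → ℕ) (i : ℕ) : ℕ → Prop
  | refl : Desc par i i
  | step {j : ℕ} : par j < j → Desc par i (par j) → Desc par i j

namespace Desc

variable {par : ℕ → ℕ} {i j k : ℕ}

theorem le (h : Desc par i j) : i ≤ j := by
  induction h with
  | refl => exact le_rfl
  | step hj _ ih => omega

theorem trans (h₁ : Desc par i j) (h₂ : Desc par j k) : Desc par i k := by
  induction h₂ with
  | refl => exact h₁
  | step hj _ ih => exact .step hj ih

/-- The ancestors of `k` form a chain along which numbers decrease, so subtrees are nested or
disjoint. -/
theorem of_common (h₁ : Desc par i k) (h₂ : Desc par j k) (hij : i ≤ j) : Desc par i j := by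
  induction h₂ with
  | refl => exact h₁
  | step hk h ih =>
    cases h₁ with
    | refl => have := h.le; omega
    | step _ h₁ => exact ih h₁

theorem exists_child (h : Desc par i j) (hij : j ≠ i) :
    ∃ c, par c = i ∧ i < c ∧ Desc par c j := by
  induction h with
  | refl => exact absurd rfl hij
  | @step j hj h ih =>
    by_cases hp : par j = i
    · exact ⟨j, hp, hp ▸ hj, .refl⟩
    · obtain ⟨c, hc, hic, hcj⟩ := ih hp
      exact ⟨c, hc, hic, .step hj hcj⟩

theorem iff : Desc par i j ↔ j = i ∨ par j < j ∧ Desc par i (par j) := by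
  constructor
  · rintro (_ | ⟨h₁, h₂⟩)
    · exact .inl rfl
    · exact .inr ⟨h₁, h₂⟩
  · rintro (rfl | ⟨h₁, h₂⟩)
    · exact .refl
    · exact .step h₁ h₂

end Desc

open scoped Classical in
/-- The vertices in the bags of the subtree of the node `i`. -/
noncomputable def subtreeVerts (n : ℕ) (par : ℕ → ℕ) (bag : ℕ → Finset ℕ) (i : ℕ) : Finset ℕ :=
  ((Finset.range n).filter fun j => Desc par i j).biUnion bag

open scoped Classical in
/-- The vertices of `G` that occur only in bags of the subtree of the node `i`. -/
noncomputable def interiorVerts (G : FinGraph) (n : ℕ) (par : ℕ → ℕ) (bag : ℕ → Finset ℕ) (i : ℕ) :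
    Finset ℕ :=
  G.verts \ ((Finset.range n).filter fun j => ¬ Desc par i j).biUnion bag

theorem mem_subtreeVerts {n : ℕ} {par : ℕ → ℕ} {bag : ℕ → Finset ℕ} {i v : ℕ} :
    v ∈ subtreeVerts n par bag i ↔ ∃ j < n, Desc par i j ∧ v ∈ bag j := by
  simp [subtreeVerts, and_assoc]

theorem mem_interiorVerts {G : FinGraph} {n : ℕ} {par : ℕ → ℕ} {bag : ℕ → Finset ℕ} {i v : ℕ} :
    v ∈ interiorVerts G n par bag i ↔
      v ∈ G.verts ∧ ∀ j < n, v ∈ bag j → Desc par i j := by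
  simp only [interiorVerts, Finset.mem_sdiff, Finset.mem_biUnion, Finset.mem_filter,
    Finset.mem_range, not_exists, not_and, and_imp]
  refine and_congr_right fun _ => forall_congr' fun j => forall_congr' fun _ => ?_
  tauto

namespace IsRootedDecomposition

variable {G : FinGraph} {ℓ n : ℕ} {par : ℕ → ℕ} {bag : ℕ → Finset ℕ}

theorem bag_subset_subtreeVerts {i : ℕ} (hi : i < n) : bag i ⊆ subtreeVerts n par bag i :=
  fun _ hv => mem_subtreeVerts.2 ⟨i, hi, .refl, hv⟩

theorem interior_subset_subtree (h : IsRootedDecomposition G ℓ n par bag) (i : ℕ) :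
    interiorVerts G n par bag i ⊆ subtreeVerts n par bag i := by
  intro v hv
  obtain ⟨hv, hY⟩ := mem_interiorVerts.1 hv
  obtain ⟨j, hj, hvj⟩ := (h.mem_verts_iff v).1 hv
  exact mem_subtreeVerts.2 ⟨j, hj, hY j hj hvj, hvj⟩

/-- The separation property: the bag that covers the edge contains `u` and hence belongs to the
subtree. -/
theorem mem_subtree_of_adj (h : IsRootedDecomposition G ℓ n par bag) {i u w : ℕ}
    (hu : u ∈ interiorVerts G n par bag i)
    (huw : G.Adj u w) : w ∈ subtreeVerts n par bag i := by
  obtain ⟨j, hj, huj, hwj⟩ := h.exists_bag u w huw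
  exact mem_subtreeVerts.2 ⟨j, hj, (mem_interiorVerts.1 hu).2 j hj huj, hwj⟩

theorem interior_mono {i j : ℕ} (hij : Desc par i j) :
    interiorVerts G n par bag j ⊆ interiorVerts G n par bag i := by
  intro v hv
  obtain ⟨hv, hY⟩ := mem_interiorVerts.1 hv
  exact mem_interiorVerts.2 ⟨hv, fun k hk hvk => hij.trans (hY k hk hvk)⟩

theorem disjoint_interior_subtree {i j : ℕ} (hle : i ≤ j) (hij : ¬ Desc par i j) :
    Disjoint (interiorVerts G n par bag j) (subtreeVerts n par bag i) := by
  rw [Finset.disjoint_left]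
  intro v hv hvi
  obtain ⟨k, hk, hik, hvk⟩ := mem_subtreeVerts.1 hvi
  exact hij (hik.of_common ((mem_interiorVerts.1 hv).2 k hk hvk) hle)

theorem disjoint_interior_bag {i j : ℕ} (hi : i < n) (hij : i < j) :
    Disjoint (interiorVerts G n par bag j) (bag i) := by
  rw [Finset.disjoint_left]
  intro v hv hvi
  have := ((mem_interiorVerts.1 hv).2 i hi hvi).le
  omega

/-- Take the child `c` of `i` whose subtree has a bag containing `v`. The bags containing `v` are
connected, and the only tree edge leaving the subtree of `c` ends in `i`, whose bag omits `v`. Hence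
`v` occurs only below `c`. -/
theorem exists_interior_of_subtree (h : IsRootedDecomposition G ℓ n par bag) {i v : ℕ}
    (hv : v ∈ subtreeVerts n par bag i) (hvi : v ∉ bag i) : ∃ c < n, i < c ∧ v ∈ interiorVerts G n par bag c := by
  obtain ⟨k, hk, hik, hvk⟩ := mem_subtreeVerts.1 hv
  obtain ⟨c, hpc, hic, hck⟩ := hik.exists_child (by rintro rfl; exact hvi hvk)
  refine ⟨c, hck.le.trans_lt hk, hic,
    mem_interiorVerts.2 ⟨(h.mem_verts_iff v).2 ⟨k, hk, hvk⟩, fun j hj hvj => ?_⟩⟩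
  by_contra hcj
  obtain ⟨a, b, -, -, hva, hvb, hca, hcb, ⟨hab, hp⟩ | ⟨hab, hp⟩⟩ :=
    h.cross_bag v (Desc par c) k j hk hj hvk hvj hck hcj
  · exact hcb (.step (hp ▸ hab) (hp ▸ hca))
  · rcases Desc.iff.1 hca with rfl | ⟨-, hca⟩
    · exact hvi (hpc ▸ hp ▸ hvb)
    · exact hcb (hp ▸ hca)

theorem interior_root (h : IsRootedDecomposition G ℓ n par bag) :
    interiorVerts G n par bag 0 = G.verts := by
  refine Finset.Subset.antisymm Finset.sdiff_subset fun v hv =>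
    mem_interiorVerts.2 ⟨hv, fun j hj _ => ?_⟩
  by_contra h0
  obtain ⟨a, b, -, -, hca, hcb, ⟨hab, hp⟩ | ⟨hab, hp⟩⟩ :=
    h.cross (Desc par 0) 0 j h.pos hj .refl h0
  · exact hcb (.step (hp ▸ hab) (hp ▸ hca))
  · rcases Desc.iff.1 hca with rfl | ⟨-, hca⟩
    · omega
    · exact hcb (hp ▸ hca)

end IsRootedDecomposition

/-- The invariant of the sweep through the nodes of a rooted tree decomposition, after the nodes
`≥ k` have been treated. `R` is the set of remaining vertices, `E` lists disjoint parts of the graph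
with solutions for them, and `D` lists the separators that have been cut out. -/
structure SweepInvariant (P : GraphProblem) (G : FinGraph) (ℓ n : ℕ) (par : ℕ → ℕ)
    (bag : ℕ → Finset ℕ) (β κ : ℝ) (k : ℕ) (R : Finset ℕ) (E : List (Finset ℕ × Data))
    (D : List (Finset ℕ)) : Prop where
  subset : R ⊆ G.verts
  pieces : ∀ e ∈ E, e.1 ⊆ G.verts ∧ P.NearOpt β 0 (G.induce e.1) e.2
  alive_or_dead : ∀ e ∈ E, (∃ j, k ≤ j ∧ j < n ∧ e.1 = interiorVerts G n par bag j ∩ R) ∨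
    (Disjoint e.1 R ∧ G.NonAdj e.1 R)
  pairwise : E.Pairwise fun e e' => Disjoint e.1 e'.1 ∧ G.NonAdj e.1 e'.1
  cuts : ∀ X ∈ D, X ⊆ G.verts ∧ X.card ≤ ℓ + 1 ∧ Disjoint X R ∧ ∀ e ∈ E, Disjoint X e.1
  cuts_pairwise : D.Pairwise Disjoint
  covered : ∀ v ∈ R, ∀ j, k ≤ j → j < n → v ∈ interiorVerts G n par bag j → ∃ e ∈ E, v ∈ e.1
  covered_of_removed : ∀ v ∈ G.verts, v ∉ R → (∃ X ∈ D, v ∈ X) ∨ ∃ e ∈ E, v ∈ e.1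
  heavy : ∃ Z ⊆ G.verts, Disjoint Z R ∧ G.NonAdj Z R ∧ D.length * κ ≤ P.optR (G.induce Z)

/-! ### Preservation of the sweep invariant -/

namespace SweepInvariant

variable {P : GraphProblem} {f : ℕ → ℝ} {h : ℝ → ℕ → ℕ} {φ : ℝ → ℕ → ℝ} {G : FinGraph} {ℓ n : ℕ}
  {par : ℕ → ℕ} {bag : ℕ → Finset ℕ} {β κ : ℝ} {k : ℕ} {R : Finset ℕ}
  {E : List (Finset ℕ × Data)} {D : List (Finset ℕ)}

theorem start (hP : P.IsFriendly f h φ) : SweepInvariant P G ℓ n par bag β κ n G.verts [] [] where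
  subset := subset_rfl
  pieces := by simp
  alive_or_dead := by simp
  pairwise := by simp
  cuts := by simp
  cuts_pairwise := by simp
  covered := fun _ _ j hj hj' => by omega
  covered_of_removed := fun _ h h' => absurd h h'
  heavy := ⟨∅, by simp, by simp, by simp [FinGraph.NonAdj], by simpa using hP.optR_nonneg _⟩

open scoped Classical in
-- An earlier part that still belongs to `R` is contained in the new one or disjoint from the whole
-- subtree, since subtrees are nested or disjoint. So dropping the parts that meet the new one loses
-- no vertex, and those kept are not adjacent to it.
theorem light (hT : IsRootedDecomposition G ℓ n par bag)
    (hI : SweepInvariant P G ℓ n par bag β κ (k + 1) R E D) (hk : k < n) {s : Data}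
    (hs : P.NearOpt β 0 (G.induce (interiorVerts G n par bag k ∩ R)) s) :
    SweepInvariant P G ℓ n par bag β κ k R ((interiorVerts G n par bag k ∩ R, s) ::
      E.filter fun e => Disjoint e.1 (interiorVerts G n par bag k ∩ R)) D := by
  set H := interiorVerts G n par bag k ∩ R with hH
  have hHR : H ⊆ R := Finset.inter_subset_right
  have hHV : H ⊆ subtreeVerts n par bag k :=
    Finset.inter_subset_left.trans (hT.interior_subset_subtree k)
  -- a part that is not yet cut off lies inside `H` or is disjoint from the subtree
  have hdich : ∀ j, k + 1 ≤ j → interiorVerts G n par bag j ∩ R ⊆ H ∨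
      Disjoint (interiorVerts G n par bag j ∩ R) (subtreeVerts n par bag k) := by
    intro j hj
    by_cases hkj : Desc par k j
    · exact .inl (Finset.inter_subset_inter_right
        (IsRootedDecomposition.interior_mono hkj))
    · exact .inr ((IsRootedDecomposition.disjoint_interior_subtree (by omega) hkj).mono_left
        Finset.inter_subset_left)
  refine ⟨hI.subset, ?_, ?_, ?_, ?_, hI.cuts_pairwise, ?_, ?_, hI.heavy⟩
  · intro e he
    rcases List.mem_cons.1 he with rfl | he
    · exact ⟨hHR.trans hI.subset, hs⟩
    · exact hI.pieces e (List.mem_of_mem_filter he)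
  · intro e he
    rcases List.mem_cons.1 he with rfl | he
    · exact .inl ⟨k, le_rfl, hk, rfl⟩
    · refine (hI.alive_or_dead e (List.mem_of_mem_filter he)).imp_left ?_
      rintro ⟨j, hj, h⟩
      exact ⟨j, by omega, h⟩
  · refine List.pairwise_cons.2 ⟨fun e he => ?_, hI.pairwise.filter _⟩
    obtain ⟨heE, hdis⟩ := List.mem_filter.1 he
    have hdis : Disjoint e.1 H := by simpa using hdis
    refine ⟨hdis.symm, fun u hu w hw huw => ?_⟩
    rcases hI.alive_or_dead e heE with ⟨j, hj, -, hej⟩ | ⟨-, hna⟩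
    · rcases hdich j hj with hsub | hd
      · exact Finset.disjoint_left.1 hdis hw (hsub (hej ▸ hw))
      · exact Finset.disjoint_left.1 hd (hej ▸ hw)
          (hT.mem_subtree_of_adj (Finset.mem_inter.1 hu).1 huw)
    · exact hna.symm u (hHR hu) w hw huw
  · intro X hX
    obtain ⟨h₁, h₂, h₃, h₄⟩ := hI.cuts X hX
    refine ⟨h₁, h₂, h₃, fun e he => ?_⟩
    rcases List.mem_cons.1 he with rfl | he
    · exact h₃.mono_right hHR
    · exact h₄ e (List.mem_of_mem_filter he)
  · intro v hv j hj hjn hvj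
    by_cases hvH : v ∈ H
    · exact ⟨_, List.mem_cons_self, hvH⟩
    have hjk : j ≠ k := by
      rintro rfl
      exact hvH (Finset.mem_inter.2 ⟨hvj, hv⟩)
    obtain ⟨e, he, hve⟩ := hI.covered v hv j (by omega) hjn hvj
    refine ⟨e, List.mem_cons_of_mem _ (List.mem_filter.2 ⟨he, ?_⟩), hve⟩
    rcases hI.alive_or_dead e he with ⟨j', hj', -, hej⟩ | ⟨hd, -⟩
    · rcases hdich j' hj' with hsub | hd
      · exact absurd (hsub (hej ▸ hve)) hvH
      · simpa [hej] using hd.mono_right hHV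
    · exact absurd hv (Finset.disjoint_left.1 hd hve)
  · intro v hv hvR
    refine (hI.covered_of_removed v hv hvR).imp_right ?_
    rintro ⟨e, he, hve⟩
    refine ⟨e, List.mem_cons_of_mem _ (List.mem_filter.2 ⟨he, ?_⟩), hve⟩
    rcases hI.alive_or_dead e he with ⟨j', -, -, hej⟩ | ⟨hd, -⟩
    · rw [hej] at hve
      exact absurd (Finset.mem_inter.1 hve).2 hvR
    · simpa using hd.mono_right hHR

/-- Removing the whole subtree from `R` makes the heavy set non-adjacent to what remains, so its
optimum adds to those of earlier heavy sets. Removed vertices outside the bag of `k` lie in the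
interior of a node already treated and are therefore covered by a part. The heavy set itself gets no
new solution. -/
theorem cut (hP : P.IsFriendly f h φ) (hT : IsRootedDecomposition G ℓ n par bag)
    (hI : SweepInvariant P G ℓ n par bag β κ (k + 1) R E D) (hk : k < n)
    (hκ : κ ≤ P.optR (G.induce (interiorVerts G n par bag k ∩ R))) :
    SweepInvariant P G ℓ n par bag β κ k (R \ subtreeVerts n par bag k) E
      ((bag k ∩ R) :: D) := by
  set H := interiorVerts G n par bag k ∩ R with hH
  have hHR : H ⊆ R := Finset.inter_subset_right
  have hsub : R \ subtreeVerts n par bag k ⊆ R := Finset.sdiff_subset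
  have hHd : Disjoint H (R \ subtreeVerts n par bag k) := Finset.disjoint_left.2 fun v hv hv' =>
    (Finset.mem_sdiff.1 hv').2 (hT.interior_subset_subtree k (Finset.mem_inter.1 hv).1)
  have hHn : G.NonAdj H (R \ subtreeVerts n par bag k) := fun u hu w hw huw =>
    (Finset.mem_sdiff.1 hw).2 (hT.mem_subtree_of_adj (Finset.mem_inter.1 hu).1 huw)
  refine ⟨hsub.trans hI.subset, hI.pieces, ?_, hI.pairwise, ?_, ?_, ?_, ?_, ?_⟩
  · intro e he
    rcases hI.alive_or_dead e he with ⟨j, hj, hjn, hej⟩ | ⟨hd, hn⟩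
    · by_cases hkj : Desc par k j
      · have heH : e.1 ⊆ H := hej ▸ Finset.inter_subset_inter_right
          (IsRootedDecomposition.interior_mono hkj)
        exact .inr ⟨hHd.mono_left heH, fun u hu => hHn u (heH hu)⟩
      -- For `j` outside the subtree of `k`, the interior of `j` avoids everything removed, so
      -- intersecting with the smaller set changes nothing.
      · refine .inl ⟨j, by omega, hjn, ?_⟩
        have hd := IsRootedDecomposition.disjoint_interior_subtree (G := G) (n := n) (bag := bag)
          (by omega : k ≤ j) hkj
        rw [hej, ← Finset.inter_sdiff_assoc,
          Finset.sdiff_eq_self_of_disjoint (hd.mono_left Finset.inter_subset_left)]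
    · exact .inr ⟨hd.mono_right hsub, fun u hu w hw => hn u hu w (hsub hw)⟩
  · intro X hX
    rcases List.mem_cons.1 hX with rfl | hX
    · refine ⟨Finset.inter_subset_right.trans hI.subset,
        (Finset.card_le_card Finset.inter_subset_left).trans (hT.card_le k hk), ?_, fun e he => ?_⟩
      · exact Finset.disjoint_left.2 fun v hv hv' => (Finset.mem_sdiff.1 hv').2
          (IsRootedDecomposition.bag_subset_subtreeVerts hk (Finset.mem_inter.1 hv).1)
      · rcases hI.alive_or_dead e he with ⟨j, hj, -, hej⟩ | ⟨hd, -⟩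
        · rw [hej]
          exact ((IsRootedDecomposition.disjoint_interior_bag hk (by omega)).symm.mono
            Finset.inter_subset_left Finset.inter_subset_left)
        · exact hd.symm.mono_left Finset.inter_subset_right
    · obtain ⟨h₁, h₂, h₃, h₄⟩ := hI.cuts X hX
      exact ⟨h₁, h₂, h₃.mono_right hsub, h₄⟩
  · refine List.pairwise_cons.2 ⟨fun X hX => ?_, hI.cuts_pairwise⟩
    exact (hI.cuts X hX).2.2.1.symm.mono_left Finset.inter_subset_right
  · intro v hv j hj hjn hvj
    have hjk : j ≠ k := by
      rintro rfl
      exact (Finset.mem_sdiff.1 hv).2 (hT.interior_subset_subtree j hvj)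
    exact hI.covered v (hsub hv) j (by omega) hjn hvj
  · intro v hv hvR
    by_cases hvR' : v ∈ R
    · have hvk : v ∈ subtreeVerts n par bag k := by
        by_contra hvk
        exact hvR (Finset.mem_sdiff.2 ⟨hvR', hvk⟩)
      by_cases hvb : v ∈ bag k
      · exact .inl ⟨_, List.mem_cons_self, Finset.mem_inter.2 ⟨hvb, hvR'⟩⟩
      · obtain ⟨c, hcn, hkc, hvc⟩ := hT.exists_interior_of_subtree hvk hvb
        exact .inr (hI.covered v hvR' c hkc hcn hvc)
    · refine (hI.covered_of_removed v hv hvR').imp_left ?_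
      rintro ⟨X, hX, hvX⟩
      exact ⟨X, List.mem_cons_of_mem _ hX, hvX⟩
  · obtain ⟨Z, hZ, hZR, hZn, hZκ⟩ := hI.heavy
    refine ⟨Z ∪ H, Finset.union_subset hZ (hHR.trans hI.subset), ?_, ?_, ?_⟩
    · exact Finset.disjoint_union_left.2 ⟨hZR.mono_right hsub, hHd⟩
    · intro u hu w hw
      rcases Finset.mem_union.1 hu with hu | hu
      · exact hZn u hu w (hsub hw)
      · exact hHn u hu w hw
    · rw [hP.optR_union (FinGraph.isDisjointUnion_induce hZ (hHR.trans hI.subset)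
        (hZR.mono_right hHR) fun u hu w hw => hZn u hu w (hHR hw)), List.length_cons]
      push_cast
      linarith

theorem cover (hT : IsRootedDecomposition G ℓ n par bag)
    (hI : SweepInvariant P G ℓ n par bag β κ 0 R E D) {v : ℕ} (hv : v ∈ G.verts) :
    (∃ X ∈ D, v ∈ X) ∨ ∃ e ∈ E, v ∈ e.1 := by
  by_cases hvR : v ∈ R
  · exact .inr (hI.covered v hvR 0 le_rfl hT.pos (hT.interior_root ▸ hv))
  · exact hI.covered_of_removed v hv hvR

end SweepInvariant

/-- Used for `numbered`, where each step copies a growing counter, so the growth is not controlled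
by the environment and the list element alone. -/
theorem PolyTime.foldl_of_bound {f : Data → Data → Data → Data} {l s₀ : Data → Data}
    (hl : PolyTime l) (hs₀ : PolyTime s₀) (hf : PolyTime fun y => f y.head y.tail.head y.tail.tail)
    (hB : ∃ B : Polynomial ℕ, ∀ x k, k <+: (l x).toList →
      (k.foldl (fun s a => f x a s) (s₀ x)).size ≤ B.eval x.size) :
    PolyTime fun x => (l x).toList.foldl (fun s a => f x a s) (s₀ x) := by
  obtain ⟨B, hB⟩ := hB
  have hin : PolyTime fun x => Data.cons x (Data.cons (l x) (s₀ x)) := by fun_prop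
  refine (Alg.comp hin (Alg.foldl hf B)).weaken ?_
  intro O Q x Φ hΦ
  refine ⟨fun k s => ∃ k₀, k₀ ++ k = (l x).toList ∧ s = k₀.foldl (fun s a => f x a s) (s₀ x),
    ⟨[], rfl, rfl⟩, ?_, ?_, ?_⟩
  · rintro a k s ⟨k₀, hk, rfl⟩
    exact ⟨k₀ ++ [a], by simpa using hk, by simp⟩
  · rintro k s ⟨k₀, hk, rfl⟩
    refine (hB x k₀ ⟨k, hk⟩).trans (eval_mono B ?_)
    simp only [Data.size]
    omega
  · rintro s ⟨k₀, hk, rfl⟩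
    rw [List.append_nil] at hk
    rwa [hk]

/-! ### Codes of sets -/

theorem isSetCode_nil : IsSetCode .nil ∅ := ⟨[], rfl, rfl⟩

theorem IsSetCode.mem_iff {x : Data} {X : Finset ℕ} (hx : IsSetCode x X) {v : ℕ} :
    ofNat v ∈ x.toList ↔ v ∈ X := by
  obtain ⟨l, rfl, rfl⟩ := hx
  simp [ofNatList]

theorem IsSetCode.eq_nil_iff {x : Data} {X : Finset ℕ} (hx : IsSetCode x X) :
    x = .nil ↔ X = ∅ := by
  obtain ⟨l, rfl, rfl⟩ := hx
  cases l <;> simp [ofNatList, ofList]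

open scoped Classical in
/-- The elements of the list `x` that are in the list `y`. -/
noncomputable def keep (x y : Data) : Data := ofList (x.toList.filter fun a => a ∈ y.toList)

open scoped Classical in
/-- The elements of the list `x` that are not in the list `y`. -/
noncomputable def drop (x y : Data) : Data := ofList (x.toList.filter fun a => a ∉ y.toList)

/-- The concatenation of two lists. -/
def append (x y : Data) : Data := ofList (x.toList ++ y.toList)

@[fun_prop]
theorem PolyTime.keep {f g : Data → Data} (hf : PolyTime f) (hg : PolyTime g) :
    PolyTime fun x => keep (f x) (g x) :=
  PolyTime.filter (p := fun x a => a ∈ (g x).toList) hf (by fun_prop)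

@[fun_prop]
theorem PolyTime.drop {f g : Data → Data} (hf : PolyTime f) (hg : PolyTime g) :
    PolyTime fun x => drop (f x) (g x) :=
  PolyTime.filter (p := fun x a => a ∉ (g x).toList) hf (by fun_prop)

@[fun_prop]
theorem PolyTime.append {f g : Data → Data} (hf : PolyTime f) (hg : PolyTime g) :
    PolyTime fun x => append (f x) (g x) := by
  refine (PolyTime.foldr (f := fun _ a s => .cons a s) hf hg (by fun_prop)
    ⟨.X + 1, fun x a s => by simp [Data.size]; omega⟩).of_eq fun x => ?_
  rw [ApproxTuring.append]
  induction (f x).toList with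
  | nil => simp
  | cons a l ih => simp [ih, ofList]

theorem size_filter_le (x : Data) (p : Data → Bool) :
    (ofList (x.toList.filter p)).size ≤ x.size := by
  simpa using size_ofList_sublist (List.filter_sublist (p := p) (l := x.toList))

theorem size_keep_le (x y : Data) : (keep x y).size ≤ x.size := size_filter_le _ _

theorem size_drop_le (x y : Data) : (drop x y).size ≤ x.size := size_filter_le _ _

theorem size_append (x y : Data) : (append x y).size + 1 = x.size + y.size := by
  unfold append
  induction x with
  | nil => simp [Data.size]; omega
  | cons a l _ ih => simp only [toList_cons, List.cons_append, ofList, Data.size]; omega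

section

variable {x y : Data} {X Y : Finset ℕ}

theorem IsSetCode.keep (hx : IsSetCode x X) (hy : IsSetCode y Y) :
    IsSetCode (keep x y) (X ∩ Y) := by
  obtain ⟨l, rfl, rfl⟩ := hx
  refine ⟨l.filter fun v => v ∈ Y, ?_, ?_⟩
  · simp [ApproxTuring.keep, ofNatList, List.filter_map, Function.comp_def, hy.mem_iff]
  · ext v
    simp

theorem IsSetCode.drop (hx : IsSetCode x X) (hy : IsSetCode y Y) :
    IsSetCode (drop x y) (X \ Y) := by
  obtain ⟨l, rfl, rfl⟩ := hx
  refine ⟨l.filter fun v => v ∉ Y, ?_, ?_⟩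
  · simp [ApproxTuring.drop, ofNatList, List.filter_map, Function.comp_def, hy.mem_iff]
  · ext v
    simp

theorem IsSetCode.append (hx : IsSetCode x X) (hy : IsSetCode y Y) :
    IsSetCode (append x y) (X ∪ Y) := by
  obtain ⟨l, rfl, rfl⟩ := hx
  obtain ⟨k, rfl, rfl⟩ := hy
  exact ⟨l ++ k, by simp [ApproxTuring.append, ofNatList], by simp⟩

end

/-! ### Restriction of graphs and instances to induced subgraphs -/

open scoped Classical in
/-- Restriction of the code `g` of a graph to the vertices in the list `u`. -/
noncomputable def restrictGraph (g u : Data) : Data :=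
  cons (keep g.head u)
    (ofList (g.tail.toList.filter fun e => e.head ∈ u.toList ∧ e.tail ∈ u.toList))

/-- Restriction of the code `d` of an instance to the vertices in the list `u`. -/
noncomputable def restrictInstance (d u : Data) : Data :=
  cons (restrictGraph d.head u)
    (cons (ofList (d.tail.head.toList.map fun e => cons e.head (keep e.tail u))) d.tail.tail)

@[fun_prop]
theorem PolyTime.restrictGraph {f g : Data → Data} (hf : PolyTime f) (hg : PolyTime g) :
    PolyTime fun x => restrictGraph (f x) (g x) :=
  PolyTime.cons (by fun_prop) (PolyTime.filter
    (p := fun x e => e.head ∈ (g x).toList ∧ e.tail ∈ (g x).toList) hf.tail (by fun_prop))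

@[fun_prop]
theorem PolyTime.restrictInstance {f g : Data → Data} (hf : PolyTime f) (hg : PolyTime g) :
    PolyTime fun x => restrictInstance (f x) (g x) :=
  PolyTime.cons (by fun_prop) (PolyTime.cons (PolyTime.map
    (f := fun x e => .cons e.head (ApproxTuring.keep e.tail (g x))) hf.tail.head (by fun_prop))
      (by fun_prop))

/-- Together with `size_le` this bounds the solutions of all induced subgraphs by one polynomial in
the input length, however many algorithms have been applied in succession. -/
theorem size_restrictGraph_le {g : Data} {G : FinGraph} (hg : IsGraphCode g G) (u : Data) :
    (restrictGraph g u).size ≤ g.size := by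
  obtain ⟨vs, es, rfl, -, -⟩ := hg
  have h₁ := size_keep_le (ofNatList vs) u
  have h₂ := size_filter_le (ofList (es.map fun e => cons (ofNat e.1) (ofNat e.2)))
  simp only [restrictGraph, Data.size, head_cons, tail_cons] at *
  exact Nat.add_le_add_right (Nat.add_le_add h₁ (h₂ _)) 1

theorem IsGraphCode.vertices {g : Data} {G : FinGraph} (hg : IsGraphCode g G) :
    IsSetCode g.head G.verts := by
  obtain ⟨vs, es, rfl, h, -⟩ := hg
  exact ⟨vs, rfl, h⟩

theorem IsGraphCode.restrict {g u : Data} {G : FinGraph} {U : Finset ℕ} (hg : IsGraphCode g G)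
    (hu : IsSetCode u U) : IsGraphCode (restrictGraph g u) (G.induce U) := by
  obtain ⟨l, hl, hl'⟩ := hg.vertices.keep hu
  obtain ⟨vs, es, rfl, -, hes⟩ := hg
  refine ⟨l, es.filter fun e => e.1 ∈ U ∧ e.2 ∈ U, ?_, ?_, fun v w => ?_⟩
  · rw [restrictGraph, hl]
    simp [List.filter_map, Function.comp_def, hu.mem_iff]
  · rw [hl']
    ext v
    rw [FinGraph.mem_induce_verts, Finset.mem_inter]
  · rw [FinGraph.induce_adj, hes]
    simp only [List.mem_filter, decide_eq_true_eq]
    tauto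

/-- The tree is kept and bags are intersected with `U`. A vertex of `U` occurs at the same nodes as
before, so connectivity is inherited; empty bags do no harm. -/
theorem IsInstanceCode.restrict {d u : Data} {G : FinGraph} {ℓ : ℕ} {U : Finset ℕ}
    (hd : IsInstanceCode d G ℓ) (hu : IsSetCode u U) :
    IsInstanceCode (restrictInstance d u) (G.induce U) ℓ := by
  obtain ⟨g, τ, 𝒯, rfl, hg, ⟨par, bags, rfl, hbags, hadj⟩, hw⟩ := hd
  let 𝒯' : TreeDecomposition (G.induce U) :=
    { n := 𝒯.n
      tree := 𝒯.tree
      isTree := 𝒯.isTree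
      bag := fun t => 𝒯.bag t ∩ U
      mem_verts_iff := fun v => by
        rw [FinGraph.mem_induce_verts, 𝒯.mem_verts_iff]
        simp
      exists_bag := fun v w hvw => by
        obtain ⟨h, hv, hw⟩ := FinGraph.induce_adj.1 hvw
        obtain ⟨t, hvt, hwt⟩ := 𝒯.exists_bag v w h
        exact ⟨t, Finset.mem_inter.2 ⟨hvt, hv⟩, Finset.mem_inter.2 ⟨hwt, hw⟩⟩
      connected := fun v hv => by
        obtain ⟨hv, hvU⟩ := FinGraph.mem_induce_verts.1 hv
        have h : {t | v ∈ 𝒯.bag t ∩ U} = {t | v ∈ 𝒯.bag t} := by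
          ext t
          simp [hvU]
        rw [h]
        exact 𝒯.connected v hv }
  refine ⟨restrictGraph g u, _, 𝒯', rfl, hg.restrict hu, ?_, fun t =>
    (Finset.card_le_card Finset.inter_subset_left).trans (hw t)⟩
  choose l hl hl' using fun i => IsSetCode.keep ⟨bags i, rfl, hbags i⟩ hu
  refine ⟨par, l, ?_, hl', hadj⟩
  simp [List.map_ofFn, Function.comp_def, hl, 𝒯']

/-! ### Computations on the nodes of a tree decomposition -/

/-- The list of the nodes in reverse order, each together with its number. -/
def numbered (τ : Data) : Data :=
  (τ.toList.foldl (fun s a => cons (cons .nil s.head) (cons (cons s.head a) s.tail))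
    (cons .nil .nil)).tail

@[fun_prop]
theorem PolyTime.numbered {f : Data → Data} (hf : PolyTime f) :
    PolyTime fun x => numbered (f x) := by
  have : PolyTime ApproxTuring.numbered := by
    refine (PolyTime.foldl_of_bound
      (f := fun _ a s => .cons (.cons .nil s.head) (.cons (.cons s.head a) s.tail)) PolyTime.id
      (.const (.cons .nil .nil)) (by fun_prop) ⟨.X * (3 * .X + 10) + 3, fun x k hk => ?_⟩).tail
    have key : ∀ k : List Data, (∀ a ∈ k, a.size ≤ x.size) → k.length ≤ x.size →
        (k.foldl (fun s a => Data.cons (.cons .nil s.head) (.cons (.cons s.head a) s.tail))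
          (.cons .nil .nil)).size ≤ k.length * (3 * x.size + 10) + 3 ∧
        (k.foldl (fun s a => Data.cons (.cons .nil s.head) (.cons (.cons s.head a) s.tail))
          (.cons .nil .nil)).head.size = 2 * k.length + 1 ∧
        (k.foldl (fun s a => Data.cons (.cons .nil s.head) (.cons (.cons s.head a) s.tail))
          (.cons .nil .nil)).tail.size ≤ k.length * (3 * x.size + 8) + 1 := by
      intro k
      induction k using List.reverseRecOn with
      | nil => simp [Data.size]
      | append_singleton k a ih =>
        intro ha hk
        simp only [List.length_append, List.length_singleton] at hk
        obtain ⟨h₁, h₂, h₃⟩ := ih (fun b hb => ha b (by simp [hb])) (by omega)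
        have := ha a (by simp)
        simp only [List.foldl_append, List.foldl_cons, List.foldl_nil, Data.size, head_cons,
          tail_cons, List.length_append, List.length_singleton, Nat.add_mul, Nat.one_mul, h₂]
        refine ⟨?_, by omega, by omega⟩
        have h₄ : k.length * (3 * x.size + 10) = k.length * (3 * x.size + 8) + 2 * k.length := by
          ring
        omega
    have hlen := hk.length_le.trans (length_toList_le x)
    refine (key k (fun a ha => size_le_of_mem_toList (hk.subset ha)) hlen).1.trans ?_
    simp only [Polynomial.eval_add, Polynomial.eval_mul, Polynomial.eval_X, Polynomial.eval_ofNat]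
    exact Nat.add_le_add_right (Nat.mul_le_mul_right _ hlen) 3
  exact this.comp hf

theorem numbered_ofList (n : ℕ) (e : ℕ → Data) :
    numbered (ofList ((List.range n).map e)) =
      ofList ((List.range n).map fun i => cons (ofNat i) (e i)).reverse := by
  have key : ((List.range n).map e).foldl
      (fun s a => cons (cons .nil s.head) (cons (cons s.head a) s.tail)) (cons .nil .nil) =
      cons (ofNat n) (ofList ((List.range n).map fun i => cons (ofNat i) (e i)).reverse) := by
    induction n with
    | zero => rfl
    | succ n ih => simp [List.range_succ, List.foldl_append, ih, ofNat, ofList]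
  simp [numbered, key]

open scoped Classical in
/-- The list of the numbers of the descendants of the node with number `i`, where `τ` lists the
numbered nodes. -/
noncomputable def descendants (τ i : Data) : Data :=
  τ.toList.foldl (fun s a => if a.head = i ∨ a.tail.head ∈ s.toList then cons a.head s else s) .nil

open scoped Classical in
/-- Removal from `r` of the vertices in bags of nodes that are not in the list `s`. -/
noncomputable def removeOutside (τ s r : Data) : Data :=
  τ.toList.foldl (fun r a => if a.head ∈ s.toList then r else drop r a.tail.tail) r

open scoped Classical in
/-- Removal from `r` of the vertices in bags of nodes that are in the list `s`. -/
noncomputable def removeInside (τ s r : Data) : Data :=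
  τ.toList.foldl (fun r a => if a.head ∈ s.toList then drop r a.tail.tail else r) r

@[fun_prop]
theorem PolyTime.descendants {f g : Data → Data} (hf : PolyTime f) (hg : PolyTime g) :
    PolyTime fun x => descendants (f x) (g x) := by
  classical
  refine PolyTime.foldl (f := fun x a s =>
    if a.head = g x ∨ a.tail.head ∈ s.toList then .cons a.head s else s) hf (.const .nil)
    (by fun_prop) ⟨.X + 1, fun x a s => ?_⟩
  have := a.size_head_le
  split_ifs <;> simp [Data.size]
  omega

@[fun_prop]
theorem PolyTime.removeOutside {f g k : Data → Data} (hf : PolyTime f) (hg : PolyTime g)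
    (hk : PolyTime k) : PolyTime fun x => removeOutside (f x) (g x) (k x) := by
  classical
  refine PolyTime.foldl (f := fun x a r =>
    if a.head ∈ (g x).toList then r else ApproxTuring.drop r a.tail.tail) hf hk
    (by fun_prop) ⟨0, fun x a s => ?_⟩
  have := size_drop_le s a.tail.tail
  split_ifs <;> simp
  omega

@[fun_prop]
theorem PolyTime.removeInside {f g k : Data → Data} (hf : PolyTime f) (hg : PolyTime g)
    (hk : PolyTime k) : PolyTime fun x => removeInside (f x) (g x) (k x) := by
  classical
  refine PolyTime.foldl (f := fun x a r =>
    if a.head ∈ (g x).toList then ApproxTuring.drop r a.tail.tail else r) hf hk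
    (by fun_prop) ⟨0, fun x a s => ?_⟩
  have := size_drop_le s a.tail.tail
  split_ifs <;> simp
  omega

theorem size_removeOutside_le (τ s r : Data) : (removeOutside τ s r).size ≤ r.size := by
  unfold removeOutside
  induction τ.toList generalizing r with
  | nil => exact le_rfl
  | cons a l ih =>
    refine (ih _).trans ?_
    beta_reduce
    split_ifs
    exacts [le_rfl, size_drop_le _ _]

theorem size_removeInside_le (τ s r : Data) : (removeInside τ s r).size ≤ r.size := by
  unfold removeInside
  induction τ.toList generalizing r with
  | nil => exact le_rfl
  | cons a l ih =>
    refine (ih _).trans ?_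
    beta_reduce
    split_ifs
    exacts [size_drop_le _ _, le_rfl]

section

variable {n : ℕ} {par : ℕ → ℕ} {bags : ℕ → List ℕ} {i : ℕ}

/-- The list of the first `n` nodes with their numbers, parents and bags. -/
def nodeList (n : ℕ) (par : ℕ → ℕ) (bags : ℕ → List ℕ) : List Data :=
  (List.range n).map fun i => cons (ofNat i) (cons (ofNat (par i)) (ofNatList (bags i)))

theorem nodeList_succ : nodeList (n + 1) par bags = nodeList n par bags ++
    [cons (ofNat n) (cons (ofNat (par n)) (ofNatList (bags n)))] := by
  simp [nodeList, List.range_succ]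

section

variable {s : Data}

theorem descendants_succ (h : n = i ∨
    ofNat (par n) ∈ (descendants (ofList (nodeList n par bags)) (ofNat i)).toList) :
    descendants (ofList (nodeList (n + 1) par bags)) (ofNat i) =
      cons (ofNat n) (descendants (ofList (nodeList n par bags)) (ofNat i)) := by
  rw [← ofNat_inj] at h
  unfold descendants at h ⊢
  rw [toList_ofList] at h ⊢
  rw [toList_ofList, nodeList_succ, List.foldl_append]
  exact if_pos h

theorem descendants_succ_of_not (h : ¬ (n = i ∨
    ofNat (par n) ∈ (descendants (ofList (nodeList n par bags)) (ofNat i)).toList)) :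
    descendants (ofList (nodeList (n + 1) par bags)) (ofNat i) =
      descendants (ofList (nodeList n par bags)) (ofNat i) := by
  rw [← ofNat_inj] at h
  unfold descendants at h ⊢
  rw [toList_ofList] at h ⊢
  rw [toList_ofList, nodeList_succ, List.foldl_append]
  exact if_neg h

theorem removeOutside_succ (h : ofNat n ∈ s.toList) (r : Data) :
    removeOutside (ofList (nodeList (n + 1) par bags)) s r =
      removeOutside (ofList (nodeList n par bags)) s r := by
  unfold removeOutside
  rw [toList_ofList, toList_ofList, nodeList_succ, List.foldl_append]
  exact if_pos h

theorem removeOutside_succ_of_notMem (h : ofNat n ∉ s.toList) (r : Data) :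
    removeOutside (ofList (nodeList (n + 1) par bags)) s r =
      drop (removeOutside (ofList (nodeList n par bags)) s r) (ofNatList (bags n)) := by
  unfold removeOutside
  rw [toList_ofList, toList_ofList, nodeList_succ, List.foldl_append]
  exact if_neg h

theorem removeInside_succ (h : ofNat n ∈ s.toList) (r : Data) :
    removeInside (ofList (nodeList (n + 1) par bags)) s r =
      drop (removeInside (ofList (nodeList n par bags)) s r) (ofNatList (bags n)) := by
  unfold removeInside
  rw [toList_ofList, toList_ofList, nodeList_succ, List.foldl_append]
  exact if_pos h

theorem removeInside_succ_of_notMem (h : ofNat n ∉ s.toList) (r : Data) :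
    removeInside (ofList (nodeList (n + 1) par bags)) s r =
      removeInside (ofList (nodeList n par bags)) s r := by
  unfold removeInside
  rw [toList_ofList, toList_ofList, nodeList_succ, List.foldl_append]
  exact if_neg h

end

/-- Parents come before children in the list, so when a node is reached, membership of its parent in
the result is already decided. -/
theorem mem_descendants (j : ℕ) :
    ofNat j ∈ (descendants (ofList (nodeList n par bags)) (ofNat i)).toList ↔
      j < n ∧ Desc par i j := by
  induction n generalizing j with
  | zero => simp [nodeList, descendants, ofList]
  | succ n ih =>
    by_cases h : n = i ∨
        ofNat (par n) ∈ (descendants (ofList (nodeList n par bags)) (ofNat i)).toList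
    · rw [descendants_succ h, toList_cons, List.mem_cons, ofNat_inj, ih]
      rw [ih, ← Desc.iff] at h
      constructor
      · rintro (rfl | ⟨h₁, h₂⟩)
        · exact ⟨by omega, h⟩
        · exact ⟨by omega, h₂⟩
      · rintro ⟨h₁, h₂⟩
        by_cases hj : j = n
        · exact .inl hj
        · exact .inr ⟨by omega, h₂⟩
    · rw [descendants_succ_of_not h, ih]
      rw [ih, ← Desc.iff] at h
      constructor
      · rintro ⟨h₁, h₂⟩
        exact ⟨by omega, h₂⟩
      · rintro ⟨h₁, h₂⟩
        refine ⟨lt_of_le_of_ne (by omega) ?_, h₂⟩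
        rintro rfl
        exact h h₂

theorem isSetCode_removeOutside {G : FinGraph} {r : Data} {R : Finset ℕ} (hr : IsSetCode r R)
    (hR : R ⊆ G.verts) :
    IsSetCode (removeOutside (ofList (nodeList n par bags))
      (descendants (ofList (nodeList n par bags)) (ofNat i)) r)
      (interiorVerts G n par (fun i => (bags i).toFinset) i ∩ R) := by
  classical
  set s := descendants (ofList (nodeList n par bags)) (ofNat i) with hs
  have key : ∀ k ≤ n, IsSetCode (removeOutside (ofList (nodeList k par bags)) s r)
      (R \ ((Finset.range k).filter fun j => ¬ Desc par i j).biUnion fun i => (bags i).toFinset) := by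
    intro k hk
    induction k with
    | zero => simpa [removeOutside, nodeList, ofList] using hr
    | succ k ih =>
      have hmem : ofNat k ∈ s.toList ↔ Desc par i k := by
        rw [hs, mem_descendants]
        exact and_iff_right (by omega)
      rw [Finset.range_add_one, Finset.filter_insert]
      by_cases hd : Desc par i k
      · rw [removeOutside_succ (hmem.2 hd), if_neg (not_not.2 hd)]
        exact ih (by omega)
      · rw [removeOutside_succ_of_notMem (hmem.not.2 hd), if_pos hd, Finset.biUnion_insert,
          Finset.union_comm, ← Finset.sup_eq_union, ← sdiff_sdiff_left]
        exact (ih (by omega)).drop ⟨bags k, rfl, rfl⟩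
  convert key n le_rfl using 1
  ext v
  simp only [interiorVerts, Finset.mem_inter, Finset.mem_sdiff]
  have := @hR v
  grind

theorem isSetCode_removeInside {r : Data} {R : Finset ℕ} (hr : IsSetCode r R) :
    IsSetCode (removeInside (ofList (nodeList n par bags))
      (descendants (ofList (nodeList n par bags)) (ofNat i)) r)
      (R \ subtreeVerts n par (fun i => (bags i).toFinset) i) := by
  classical
  set s := descendants (ofList (nodeList n par bags)) (ofNat i) with hs
  have key : ∀ k ≤ n, IsSetCode (removeInside (ofList (nodeList k par bags)) s r)
      (R \ ((Finset.range k).filter fun j => Desc par i j).biUnion fun i => (bags i).toFinset) := by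
    intro k hk
    induction k with
    | zero => simpa [removeInside, nodeList, ofList] using hr
    | succ k ih =>
      have hmem : ofNat k ∈ s.toList ↔ Desc par i k := by
        rw [hs, mem_descendants]
        exact and_iff_right (by omega)
      rw [Finset.range_add_one, Finset.filter_insert]
      by_cases hd : Desc par i k
      · rw [removeInside_succ (hmem.2 hd), if_pos hd, Finset.biUnion_insert,
          Finset.union_comm, ← Finset.sup_eq_union, ← sdiff_sdiff_left]
        exact (ih (by omega)).drop ⟨bags k, rfl, rfl⟩
      · rw [removeInside_succ_of_notMem (hmem.not.2 hd), if_neg hd]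
        exact ih (by omega)
  convert key n le_rfl using 1
  ext v
  simp [subtreeVerts]

end

/-- `d` encodes a set of vertices together with a solution. -/
def IsPieceCode (d : Data) (p : Finset ℕ × Data) : Prop := ∃ c, d = cons c p.2 ∧ IsSetCode c p.1

/-! ### Reassembling a solution from parts and separators -/

namespace GraphProblem

variable {P : GraphProblem}

theorem NearOpt.mono {β e e' : ℝ} {G : FinGraph} {s : Data} (h : P.NearOpt β e G s)
    (he : e ≤ e') : P.NearOpt β e' G s := by
  refine ⟨h.1, ?_⟩
  have := h.2
  cases hg : P.goal <;> simp only [hg] at this ⊢ <;> linarith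

namespace IsFriendly

variable {f : ℕ → ℝ} {h : ℝ → ℕ → ℕ} {φ : ℝ → ℕ → ℝ}

theorem exists_unite (hP : P.IsFriendly f h φ) :
    Alg fun _ _ x Φ => ∃ (G G₁ G₂ : FinGraph) (g₁ g₂ s₁ s₂ : Data) (β : ℝ),
      x = cons g₁ (cons g₂ (cons s₁ s₂)) ∧ G.IsDisjointUnion G₁ G₂ ∧
      IsGraphCode g₁ G₁ ∧ IsGraphCode g₂ G₂ ∧ P.NearOpt β 0 G₁ s₁ ∧ P.NearOpt β 0 G₂ s₂ ∧
      ∀ s, P.NearOpt β 0 G s → Φ s := by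
  obtain ⟨A, T, hA⟩ := hP.additive.unite
  refine (Alg.ofRunsIn A T).weaken ?_
  rintro O Q _ Φ ⟨G, G₁, G₂, g₁, g₂, s₁, s₂, β, rfl, hG, hg₁, hg₂, hs₁, hs₂, hΦ⟩
  obtain ⟨s, hrun, hs, hval⟩ := hA G G₁ G₂ g₁ g₂ s₁ s₂ hG hg₁ hg₂ hs₁.1 hs₂.1
  refine ⟨s, hrun, hΦ s ⟨hs, ?_⟩⟩
  rw [← hP.coe_valR hs, ← hP.coe_valR hs₁.1, ← hP.coe_valR hs₂.1, ← EReal.coe_add,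
    EReal.coe_eq_coe_iff] at hval
  have h₁ := hs₁.2
  have h₂ := hs₂.2
  cases hg : P.goal <;> simp only [hg] at h₁ h₂ ⊢ <;> rw [hP.optR_union hG, hval] <;> linarith

/-- Each goal uses the other half of the deletion axiom for optima: minimization needs that deletion
does not increase the optimum, maximization that it loses at most `f |X|`. Maximization returns the
solution unchanged. -/
theorem exists_extend (hP : P.IsFriendly f h φ) :
    Alg fun _ _ x Φ => ∃ (G : FinGraph) (X : Finset ℕ) (g u s' : Data) (β e : ℝ),
      x = cons g (cons u s') ∧ 0 ≤ β ∧ X ⊆ G.verts ∧ IsGraphCode g G ∧ IsSetCode u X ∧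
      P.NearOpt β e (G.deleteVerts X) s' ∧ ∀ s, P.NearOpt β (e + f X.card) G s → Φ s := by
  cases hgoal : P.goal
  · obtain ⟨A, T, hA⟩ := hP.loss.extend_min hgoal
    refine (Alg.ofRunsIn A T).weaken ?_
    rintro O Q _ Φ ⟨G, X, g, u, s', β, e, rfl, hβ, hX, hg, hu, hs', hΦ⟩
    obtain ⟨s, hrun, hs, hval⟩ := hA G X g u s' hX hg hu hs'.1
    refine ⟨s, hrun, hΦ s ⟨hs, ?_⟩⟩
    rw [← hP.coe_valR hs, ← hP.coe_valR hs'.1, ← EReal.coe_add, EReal.coe_le_coe_iff] at hval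
    have h₁ := hs'.2
    have h₂ := mul_le_mul_of_nonneg_left (hP.optR_delete_le hX) hβ
    simp only [hgoal] at h₁ ⊢
    linarith
  · have hout : PolyTime fun x => x.tail.tail := by fun_prop
    refine Alg.weaken hout ?_
    rintro O Q _ Φ ⟨G, X, g, u, s', β, e, rfl, hβ, hX, hg, hu, hs', hΦ⟩
    obtain ⟨hs, hval⟩ := hP.loss.extend_max hgoal G X s' hX hs'.1
    refine hΦ s' ⟨hs, ?_⟩
    rw [← hP.coe_valR hs, ← hP.coe_valR hs'.1, EReal.coe_eq_coe_iff] at hval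
    have h₁ := hs'.2
    have h₂ := hP.optR_le_delete_add hX
    simp only [hgoal] at h₁ ⊢
    rw [hval]
    linarith

/-- Solutions for pairwise non-adjacent parts of a graph are united. -/
theorem exists_uniteAll (hP : P.IsFriendly f h φ) :
    Alg fun _ _ x Φ => ∃ (G : FinGraph) (E : List (Finset ℕ × Data)) (U : Finset ℕ)
      (g e u s : Data) (β : ℝ), x = cons g (cons e (cons u s)) ∧ IsGraphCode g G ∧
      List.Forall₂ IsPieceCode e.toList E ∧ IsSetCode u U ∧ U ⊆ G.verts ∧
      P.NearOpt β 0 (G.induce U) s ∧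
      (∀ p ∈ E, p.1 ⊆ G.verts ∧ P.NearOpt β 0 (G.induce p.1) p.2 ∧ Disjoint U p.1 ∧
        G.NonAdj U p.1) ∧
      (E.Pairwise fun p p' => Disjoint p.1 p'.1 ∧ G.NonAdj p.1 p'.1) ∧
      ∀ (U' : Finset ℕ) (u' s' : Data), IsSetCode u' U' → U' ⊆ G.verts →
        P.NearOpt β 0 (G.induce U') s' → (∀ v, v ∈ U' ↔ v ∈ U ∨ ∃ p ∈ E, v ∈ p.1) →
        Φ (cons u' s') := by
  obtain ⟨bs, hbs⟩ := P.size_le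
  have hin : PolyTime fun z => cons (restrictGraph z.head z.tail.tail.head)
      (cons (restrictGraph z.head z.tail.head.head) (cons z.tail.tail.tail z.tail.head.tail)) := by
    fun_prop
  have hu : PolyTime fun z => append z.tail.tail.head z.tail.head.head := by fun_prop
  refine (Alg.foldl (Alg.pair hu (Alg.comp hin hP.exists_unite)) (.X + bs + 1)).weaken ?_
  rintro O Q _ Φ ⟨G, E, U, g, e, u, s, β, rfl, hg, he, hu, hU, hs, hE, hpw, hΦ⟩
  simp only [head_cons, tail_cons]
  refine ⟨fun l st => ∃ (E' : List (Finset ℕ × Data)) (U' : Finset ℕ) (u' s' : Data),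
    st = cons u' s' ∧ List.Forall₂ IsPieceCode l E' ∧ IsSetCode u' U' ∧ U' ⊆ G.verts ∧
    P.NearOpt β 0 (G.induce U') s' ∧
    (∀ p ∈ E', p.1 ⊆ G.verts ∧ P.NearOpt β 0 (G.induce p.1) p.2 ∧ Disjoint U' p.1 ∧
      G.NonAdj U' p.1) ∧
    (E'.Pairwise fun p p' => Disjoint p.1 p'.1 ∧ G.NonAdj p.1 p'.1) ∧
    (∀ v, (v ∈ U' ∨ ∃ p ∈ E', v ∈ p.1) ↔ v ∈ U ∨ ∃ p ∈ E, v ∈ p.1) ∧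
    u'.size + (ofList l).size ≤ u.size + e.size, ?_, ?_, ?_, ?_⟩
  · exact ⟨E, U, u, s, rfl, he, hu, hU, hs, hE, hpw, fun v => Iff.rfl, by simp⟩
  · rintro a l _ ⟨_, U', u', s', rfl, hl, hu', hU', hs', hE', hpw', hv, hsize⟩
    cases hl with
    | @cons _ p _ E' ha hl =>
    obtain ⟨c, rfl, hc⟩ := ha
    obtain ⟨hp, hps, hd, hn⟩ := hE' p List.mem_cons_self
    obtain ⟨hpE, hpw'⟩ := List.pairwise_cons.1 hpw'
    simp only [head_cons, tail_cons, ofList, Data.size] at hsize ⊢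
    refine ⟨G.induce (U' ∪ p.1), _, _, _, _, _, _, β, rfl,
      FinGraph.isDisjointUnion_induce hU' hp hd hn, hg.restrict hu', hg.restrict hc, hs', hps,
      fun s'' hs'' => ⟨E', U' ∪ p.1, _, s'', rfl, hl, hu'.append hc, Finset.union_subset hU' hp,
        hs'', fun p' hp' => ?_, hpw', fun v => ?_, ?_⟩⟩
    · obtain ⟨h₁, h₂, h₃, h₄⟩ := hE' p' (List.mem_cons_of_mem _ hp')
      refine ⟨h₁, h₂, Finset.disjoint_union_left.2 ⟨h₃, (hpE p' hp').1⟩, fun v hv => ?_⟩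
      rcases Finset.mem_union.1 hv with hv | hv
      · exact h₄ v hv
      · exact (hpE p' hp').2 v hv
    · rw [← hv v]
      simp [or_assoc]
    · have := size_append u' c
      omega
  · rintro l _ ⟨E', U', u', s', rfl, -, hu', -, hs', -, -, -, hsize⟩
    -- The solution is bounded through the graph it solves, not through the steps that produced it.
    have h₁ := (hbs _ _ s' (hg.restrict hu') hs'.1).trans
      (eval_mono bs (size_restrictGraph_le hg u'))
    have h₂ := eval_mono bs (show g.size ≤ (cons g (cons e (cons u s))).size by
      simp only [Data.size]; omega)
    simp only [Data.size, Polynomial.eval_add, Polynomial.eval_X, Polynomial.eval_one] at h₂ ⊢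
    omega
  · rintro _ ⟨_, U', u', s', rfl, hl, hu', hU', hs', -, -, hv, -⟩
    cases hl
    exact hΦ U' u' s' hu' hU' hs' fun v => by simpa using hv v

/-- A solution is extended to disjoint separators, one after the other. -/
theorem exists_extendAll (hP : P.IsFriendly f h φ) :
    Alg fun _ _ x Φ => ∃ (G : FinGraph) (D : List (Finset ℕ)) (U : Finset ℕ)
      (g d u s : Data) (β : ℝ) (m : ℕ), x = cons g (cons d (cons u s)) ∧ 0 ≤ β ∧ IsGraphCode g G ∧
      List.Forall₂ IsSetCode d.toList D ∧ IsSetCode u U ∧ U ⊆ G.verts ∧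
      P.NearOpt β 0 (G.induce U) s ∧
      (∀ X ∈ D, X ⊆ G.verts ∧ X.card ≤ m ∧ Disjoint X U) ∧ D.Pairwise Disjoint ∧
      ∀ (U' : Finset ℕ) (u' s' : Data), U' ⊆ G.verts →
        P.NearOpt β (D.length * f m) (G.induce U') s' →
        (∀ v, v ∈ U' ↔ v ∈ U ∨ ∃ X ∈ D, v ∈ X) → Φ (cons u' s') := by
  obtain ⟨bs, hbs⟩ := P.size_le
  have hin : PolyTime fun z => cons (restrictGraph z.head (append z.tail.head z.tail.tail.head))
      (cons z.tail.head z.tail.tail.tail) := by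
    fun_prop
  have hu : PolyTime fun z => append z.tail.head z.tail.tail.head := by fun_prop
  refine (Alg.foldl (Alg.pair hu (Alg.comp hin hP.exists_extend)) (.X + bs + 1)).weaken ?_
  rintro O Q _ Φ ⟨G, D, U, g, d, u, s, β, m, rfl, hβ, hg, hd, hu, hU, hs, hD, hpw, hΦ⟩
  simp only [head_cons, tail_cons]
  refine ⟨fun l st => ∃ (D' : List (Finset ℕ)) (U' : Finset ℕ) (u' s' : Data) (e : ℝ),
    st = cons u' s' ∧ List.Forall₂ IsSetCode l D' ∧ IsSetCode u' U' ∧ U' ⊆ G.verts ∧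
    P.NearOpt β e (G.induce U') s' ∧ e + D'.length * f m = D.length * f m ∧
    (∀ X ∈ D', X ⊆ G.verts ∧ X.card ≤ m ∧ Disjoint X U') ∧ D'.Pairwise Disjoint ∧
    (∀ v, (v ∈ U' ∨ ∃ X ∈ D', v ∈ X) ↔ v ∈ U ∨ ∃ X ∈ D, v ∈ X) ∧
    u'.size + (ofList l).size ≤ u.size + d.size, ?_, ?_, ?_, ?_⟩
  · exact ⟨D, U, u, s, 0, rfl, hd, hu, hU, hs, by simp, hD, hpw, fun v => Iff.rfl, by simp⟩
  · rintro a l _ ⟨_, U', u', s', e, rfl, hl, hu', hU', hs', he, hD', hpw', hv, hsize⟩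
    cases hl with
    | @cons _ X _ D' ha hl =>
    obtain ⟨hX, hXm, hXU⟩ := hD' X List.mem_cons_self
    obtain ⟨hXD, hpw'⟩ := List.pairwise_cons.1 hpw'
    simp only [head_cons, tail_cons, ofList, Data.size] at hsize ⊢
    refine ⟨G.induce (X ∪ U'), X, _, a, s', β, e, rfl, hβ, ?_, hg.restrict (ha.append hu'), ha, ?_,
      fun s'' hs'' => ⟨D', X ∪ U', _, s'', e + f m, rfl, hl, ha.append hu',
        Finset.union_subset hX hU', hs''.mono ?_, ?_, fun X' hX' => ?_, hpw', fun v => ?_, ?_⟩⟩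
    · rw [FinGraph.induce_verts (Finset.union_subset hX hU')]
      exact Finset.subset_union_left
    · rwa [FinGraph.deleteVerts_induce_union hU' hX hXU]
    · have := hP.f_mono hXm
      linarith
    · rw [← he, List.length_cons]
      push_cast
      ring
    · obtain ⟨h₁, h₂, h₃⟩ := hD' X' (List.mem_cons_of_mem _ hX')
      exact ⟨h₁, h₂, Finset.disjoint_union_right.2 ⟨(hXD X' hX').symm, h₃⟩⟩
    · rw [← hv v]
      simp only [Finset.mem_union, List.exists_mem_cons_iff]
      tauto
    · have := size_append a u'
      omega
  · rintro l _ ⟨D', U', u', s', e, rfl, -, hu', -, hs', -, -, -, -, hsize⟩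
    have h₁ := (hbs _ _ s' (hg.restrict hu') hs'.1).trans
      (eval_mono bs (size_restrictGraph_le hg u'))
    have h₂ := eval_mono bs (show g.size ≤ (cons g (cons d (cons u s))).size by
      simp only [Data.size]; omega)
    simp only [Data.size, Polynomial.eval_add, Polynomial.eval_X, Polynomial.eval_one] at h₂ ⊢
    omega
  · rintro _ ⟨_, U', u', s', e, rfl, hl, hu', hU', hs', he, -, -, hv, -⟩
    cases hl
    refine hΦ U' u' s' hU' ?_ fun v => by simpa using hv v
    rw [← he]
    simpa using hs'

end IsFriendly

end GraphProblem

/-! ### The sweep through the tree decomposition -/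

/-- The part of the graph that is treated at a node. The input `z` consists of the instance, the
numbered nodes, the current node and the state, which lists the remaining vertices, the parts with
solutions, and the separators. -/
noncomputable def sweepPart (z : Data) : Data :=
  removeOutside z.head.tail (descendants z.head.tail z.tail.head.head) z.tail.tail.head

open scoped Classical in
/-- The next state of the sweep; the input is that of `sweepPart` and the answer of the solver. -/
noncomputable def sweepNext (w : Data) : Data :=
  if w.tail = .nil then
    cons (removeInside w.head.head.tail
        (descendants w.head.head.tail w.head.tail.head.head) w.head.tail.tail.head)
      (cons w.head.tail.tail.tail.head
        (cons (keep w.head.tail.head.tail.tail w.head.tail.tail.head)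
          w.head.tail.tail.tail.tail))
  else
    cons w.head.tail.tail.head
      (cons (cons (cons (sweepPart w.head) w.tail.tail)
          (ofList (w.head.tail.tail.tail.head.toList.filter fun p =>
            keep p.head (sweepPart w.head) = .nil)))
        w.head.tail.tail.tail.tail)

@[fun_prop]
theorem PolyTime.sweepPart {g : Data → Data} (hg : PolyTime g) :
    PolyTime fun x => sweepPart (g x) := by
  unfold ApproxTuring.sweepPart
  fun_prop

open scoped Classical in
theorem polyTime_sweepNext : PolyTime sweepNext := by
  have h : PolyTime fun w => ofList (w.head.tail.tail.tail.head.toList.filter fun p =>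
      keep p.head (sweepPart w.head) = .nil) :=
    PolyTime.filter (p := fun w p => keep p.head (sweepPart w.head) = .nil) (by fun_prop)
      (by fun_prop)
  unfold sweepNext
  exact PolyTime.ite (by fun_prop) (by fun_prop)
    (.cons (by fun_prop) (.cons (.cons (by fun_prop) h) (by fun_prop)))

namespace GraphProblem.IsFriendly

variable {P : GraphProblem} {f : ℕ → ℝ} {h : ℝ → ℕ → ℕ} {φ : ℝ → ℕ → ℝ}

open scoped Classical in
/-- The sweep cuts the graph into parts with good solutions and few separators, given a solver that
finds good solutions or detects a large optimum. -/
theorem exists_sweep (hP : P.IsFriendly f h φ) {Γ : Type} {S : Spec} (hS : Alg S)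
    (Adm : (Data → Data) → (Data → Prop) → ℕ → Γ → Prop) (β : Γ → ℝ) (κ : ℕ → ℝ)
    (hsolve : ∀ O Q ℓ γ x H Φ, Adm O Q ℓ γ → IsInstanceCode x H ℓ → (κ ℓ < P.optR H → Φ .nil) →
      (∀ s, P.NearOpt (β γ) 0 H s → Φ (cons .nil s)) → S O Q x Φ) :
    Alg fun O Q x Φ => ∃ (G : FinGraph) (ℓ : ℕ) (γ : Γ), Adm O Q ℓ γ ∧ IsInstanceCode x G ℓ ∧
      ∀ (e d : Data) (n : ℕ) (par : ℕ → ℕ) (bag : ℕ → Finset ℕ) (R : Finset ℕ)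
        (E : List (Finset ℕ × Data)) (D : List (Finset ℕ)),
        List.Forall₂ IsPieceCode e.toList E → List.Forall₂ IsSetCode d.toList D →
        IsRootedDecomposition G ℓ n par bag →
        SweepInvariant P G ℓ n par bag (β γ) (κ ℓ) 0 R E D → Φ (cons e d) := by
  obtain ⟨bs, hbs⟩ := P.size_le
  have hin : PolyTime fun z => restrictInstance z.head.head (sweepPart z) := by fun_prop
  -- `numbered` reverses the list. It is folded in that order, children before parents, while the
  -- environment stores the increasing order that `descendants` requires.
  have hstart : PolyTime fun x => cons
      (cons x (ofList (numbered x.tail.head).toList.reverse))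
      (cons (numbered x.tail.head) (cons x.head.head (cons .nil .nil))) := by fun_prop
  have hout : PolyTime fun st => st.tail := by fun_prop
  refine (Alg.comp (Alg.comp hstart (Alg.foldl
    (Alg.bind hin hS polyTime_sweepNext) (.X + 10 + .X * (2 * .X + bs + 10)))) hout).weaken ?_
  rintro O Q x Φ ⟨G, ℓ, γ, hadm, hx, hΦ⟩
  obtain ⟨g, n, par, bags, hxg, hg, hT⟩ := exists_rootedDecomposition hx
  have hnum : numbered x.tail.head = ofList (nodeList n par bags).reverse := by
    rw [hxg]
    exact numbered_ofList n _
  have hgx : g.size ≤ x.size := by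
    rw [hxg]
    simp only [Data.size]
    omega
  have hxh : x.head = g := by rw [hxg, head_cons]
  beta_reduce
  rw [hnum, hxh]
  simp only [head_cons, tail_cons, toList_ofList, List.reverse_reverse]
  set bag : ℕ → Finset ℕ := fun i => (bags i).toFinset with hbag
  set τ := ofList (nodeList n par bags) with hτ
  set ρ := ofList (nodeList n par bags).reverse with hρ
  -- `K` pays for one step: a new part has a vertex list no longer than the input and a solution of
  -- size at most `bs.eval x.size`.
  set K := 2 * x.size + bs.eval x.size + 10 with hK
  refine ⟨fun l st => ∃ (k : ℕ) (r e d : Data) (R : Finset ℕ) (E : List (Finset ℕ × Data))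
    (D : List (Finset ℕ)), k ≤ n ∧ l = (nodeList k par bags).reverse ∧
    st = cons r (cons e d) ∧ IsSetCode r R ∧ List.Forall₂ IsPieceCode e.toList E ∧
    List.Forall₂ IsSetCode d.toList D ∧
    SweepInvariant P G ℓ n par bag (β γ) (κ ℓ) k R E D ∧ r.size ≤ x.size ∧
    st.size + (ofList l).size * K ≤ x.size + 10 + ρ.size * K, ?_, ?_, ?_, ?_⟩
  · have hgh : g.head.size ≤ x.size := g.size_head_le.trans hgx
    refine ⟨n, g.head, .nil, .nil, G.verts, [], [], le_rfl, rfl, rfl, hg.vertices, .nil, .nil,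
      .start hP, hgh, ?_⟩
    simp only [Data.size, ← hρ]
    omega
  · rintro a l _ ⟨k, r, e, d, R, E, D, hk, hl, rfl, hr, he, hd, hI, hrx, hsize⟩
    rcases k with _ | k
    · simp [nodeList] at hl
    rw [nodeList_succ, List.reverse_append, List.reverse_singleton, List.singleton_append,
      List.cons.injEq] at hl
    obtain ⟨rfl, rfl⟩ := hl
    set a := cons (ofNat k) (cons (ofNat (par k)) (ofNatList (bags k))) with ha
    set z := cons (cons x τ) (cons a (cons r (cons e d))) with hz
    have hy : IsSetCode (sweepPart z) (interiorVerts G n par bag k ∩ R) :=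
      isSetCode_removeOutside hr hI.subset
    have hyr : (sweepPart z).size ≤ r.size := size_removeOutside_le _ _ _
    have hmul : (ofList (a :: (nodeList k par bags).reverse)).size * K =
        a.size * K + (ofList (nodeList k par bags).reverse).size * K + K := by
      simp only [ofList, Data.size]
      ring
    rw [hmul] at hsize
    have haK : a.size ≤ a.size * K := Nat.le_mul_of_pos_right _ (by omega)
    simp only [Data.size] at hsize
    refine hsolve O Q ℓ γ _ _ _ hadm (hx.restrict hy) (fun hheavy => ?_) fun s hs => ?_
    · have hnext : sweepNext (cons z .nil) = cons (removeInside τ (descendants τ (ofNat k)) r)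
          (cons e (cons (keep (ofNatList (bags k)) r) d)) := if_pos rfl
      refine ⟨k, _, _, _, _, _, _, by omega, rfl, hnext, isSetCode_removeInside hr, he, ?_,
        hI.cut hP hT (by omega) hheavy.le, (size_removeInside_le _ _ _).trans hrx, ?_⟩
      · rw [toList_cons]
        exact .cons (IsSetCode.keep ⟨bags k, rfl, rfl⟩ hr) hd
      · rw [hnext]
        have h₁ := size_removeInside_le τ (descendants τ (ofNat k)) r
        have h₂ := size_keep_le (ofNatList (bags k)) r
        have h₃ : (ofNatList (bags k)).size ≤ a.size := by
          simp only [ha, Data.size]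
          omega
        simp only [Data.size]
        omega
    · have hnext : sweepNext (cons z (cons .nil s)) = cons r (cons (cons (cons (sweepPart z) s)
          (ofList (e.toList.filter fun p => keep p.head (sweepPart z) = .nil))) d) :=
        if_neg (by simp)
      refine ⟨k, _, _, _, _, _, _, by omega, rfl, hnext, hr, ?_, hd,
        hI.light hT (by omega) hs, hrx, ?_⟩
      · rw [toList_cons, toList_ofList]
        refine .cons ⟨_, rfl, hy⟩ (List.rel_filter ?_ he)
        rintro _ p ⟨c, rfl, hc⟩
        beta_reduce
        rw [decide_eq_true_iff, decide_eq_true_iff, Finset.disjoint_iff_inter_eq_empty]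
        exact (hc.keep hy).eq_nil_iff
      · rw [hnext]
        have h₁ := size_filter_le e fun p => keep p.head (sweepPart z) = .nil
        have h₂ := (hbs _ _ s (hg.restrict hy) hs.1).trans
          (eval_mono bs ((size_restrictGraph_le hg _).trans hgx))
        simp only [Data.size] at h₁ ⊢
        omega
  · rintro l st ⟨k, r, e, d, R, E, D, -, -, rfl, -, -, -, -, -, hsize⟩
    set N := (cons (cons x τ) (cons ρ (cons g.head (cons .nil .nil)))).size with hN
    have hxN : x.size ≤ N := by simp only [hN, Data.size]; omega
    have hρN : ρ.size ≤ N := by simp only [hN, Data.size]; omega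
    have hKN : K ≤ 2 * N + bs.eval N + 10 := by
      have := eval_mono bs hxN
      omega
    have := Nat.mul_le_mul hρN hKN
    simp only [Polynomial.eval_add, Polynomial.eval_X, Polynomial.eval_mul, Polynomial.eval_ofNat]
    omega
  · rintro _ ⟨k, r, e, d, R, E, D, -, hl, rfl, -, he, hd, hI, -, -⟩
    obtain rfl : k = 0 := by
      have := congrArg List.length hl
      simpa [nodeList] using this.symm
    exact hΦ e d n par bag R E D he hd hT hI

/-! ### The cost of the separators and the complete algorithm -/

/-- With `r` separators of cost `F`, each paid for by a heavy set of optimum at least `3 * F / ε`,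
the additive error is at most `ε / 3` times the optimum and is absorbed into the ratio. -/
theorem nearOpt_of_cuts (hP : P.IsFriendly f h φ) {ε c : ℝ} (hε : 0 < ε) (hε1 : ε ≤ 1)
    (hc : 1 ≤ c) {G : FinGraph} {s : Data} {r F : ℝ}
    (hs : P.NearOpt ((1 + ε / 3) * c) (r * F) G s) (hr : r * (3 * F / ε) ≤ P.optR G) :
    P.NearOpt ((1 + ε) * c) 0 G s := by
  refine ⟨hs.1, ?_⟩
  have h₁ := hs.2
  have h₂ : r * F ≤ ε / 3 * P.optR G := by
    have : r * F = ε / 3 * (r * (3 * F / ε)) := by field_simp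
    rw [this]
    exact mul_le_mul_of_nonneg_left hr (by positivity)
  have ho := hP.optR_nonneg G
  cases hg : P.goal <;> simp only [hg] at h₁ ⊢
  · have h₃ : ε / 3 * P.optR G ≤ ε * c * P.optR G - ε / 3 * c * P.optR G := by
      have : 0 ≤ P.optR G * ε := by positivity
      nlinarith
    nlinarith
  · have h₃ : (1 - ε / 3) * P.optR G ≤ (1 + ε / 3) * (c * P.valR G s) := by linarith
    -- Values of solutions of a maximization problem are not assumed non-negative; here the sign
    -- follows from the guarantee and `0 ≤ OPT`.
    have hv : 0 ≤ c * P.valR G s := by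
      by_contra hneg
      have : (1 + ε / 3) * (c * P.valR G s) < 0 :=
        mul_neg_of_pos_of_neg (by positivity) (not_le.1 hneg)
      have : 0 ≤ (1 - ε / 3) * P.optR G := mul_nonneg (by linarith) ho
      linarith
    have h₄ : (1 + ε / 3) * (c * P.valR G s) ≤ (1 - ε / 3) * ((1 + ε) * (c * P.valR G s)) := by
      rw [← mul_assoc (1 - ε / 3)]
      exact mul_le_mul_of_nonneg_right (by nlinarith) hv
    have h₅ := le_of_mul_le_mul_left (h₃.trans h₄) (by linarith)
    linarith

theorem hasApproxTuringKernel (hP : P.IsFriendly f h φ) {ε : ℝ} (hε : 0 < ε) (hε1 : ε ≤ 1) :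
    P.HasApproxTuringKernel (1 + ε)
      (fun ℓ => h (ε / 3) (⌊φ (6 * f (ℓ + 1) / ε + f 1) ℓ⌋₊ + ℓ)) := by
  obtain ⟨q, hsolver⟩ := hP.exists_solver hε
  let Adm : (Data → Data) → (Data → Prop) → ℕ → ℝ → Prop := fun O Q ℓ c =>
    1 ≤ c ∧ P.IsApproxOracle c O ∧ ∀ y G', IsGraphCode y G' →
      G'.verts.card ≤ h (ε / 3) (⌊φ (6 * f (ℓ + 1) / ε + f 1) ℓ⌋₊ + ℓ) →
      y.size ≤ q.eval ℓ → Q y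
  have hsweep := hP.exists_sweep hsolver Adm (fun c => (1 + ε / 3) * c)
    (fun ℓ => 3 * f (ℓ + 1) / ε) fun O Q ℓ c x H Φ hadm hx h₁ h₂ =>
      ⟨H, ℓ, c, hadm.1, hadm.2.1, hx, hadm.2.2, h₁, h₂⟩
  have hg₁ : PolyTime fun d => restrictInstance d .nil := by fun_prop
  -- the contexts are `(d, s)`, `((d, s), (e, c))` and `(((d, s), (e, c)), (u, s'))`
  have hg₂ : PolyTime fun x => x.head := by fun_prop
  have hg₃ : PolyTime fun x => cons x.head.head.head
      (cons x.tail.head (cons .nil x.head.tail.tail)) := by fun_prop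
  have hg₄ : PolyTime fun x => cons x.head.head.head.head (cons x.head.tail.tail x.tail) := by
    fun_prop
  have hout : PolyTime fun x => x.tail := by fun_prop
  obtain ⟨B, T, hB⟩ := Alg.bind hg₁ hsolver (Alg.bind hg₂ hsweep (Alg.bind hg₃ hP.exists_uniteAll
    (Alg.comp hg₄ (Alg.comp hP.exists_extendAll hout))))
  refine ⟨B, T, q, fun c O hc hO d G ℓ hd => ?_⟩
  suffices hsuff : _ by
    obtain ⟨s, t, hrun, ht, hs⟩ := hB O (fun x => ∃ G' : FinGraph, IsGraphCode x G' ∧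
      G'.verts.card ≤ h (ε / 3) (⌊φ (6 * f (ℓ + 1) / ε + f 1) ℓ⌋₊ + ℓ) ∧ x.size ≤ q.eval ℓ) d
      (P.IsApproxSolution ((1 + ε) * c) G) hsuff
    exact ⟨s, t, hrun, ht, hs⟩
  have hadm : Adm O (fun x => ∃ G' : FinGraph, IsGraphCode x G' ∧
      G'.verts.card ≤ h (ε / 3) (⌊φ (6 * f (ℓ + 1) / ε + f 1) ℓ⌋₊ + ℓ) ∧ x.size ≤ q.eval ℓ) ℓ c :=
    ⟨hc, hO, fun y G' h₁ h₂ h₃ => ⟨G', h₁, h₂, h₃⟩⟩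
  have hβ : 0 ≤ (1 + ε / 3) * c := by positivity
  -- Uniting the parts starts from a solution of the empty graph. The solver provides it: the
  -- optimum `0` is not larger than `3 f(ℓ+1)/ε ≥ 0`, so it cannot be reported as heavy.
  refine ⟨G.induce ∅, ℓ, c, hc, hO, hd.restrict isSetCode_nil, hadm.2.2, fun hheavy => ?_,
    fun s hs => ?_⟩
  · rw [hP.optR_empty (FinGraph.induce_verts (Finset.empty_subset _))] at hheavy
    exact absurd hheavy (not_lt.2 (div_nonneg (mul_nonneg (by norm_num) (hP.f_nonneg _)) hε.le))
  refine ⟨G, ℓ, c, hadm, by simpa using hd, fun e x n par bag R E D he hx hT hI => ?_⟩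
  obtain ⟨g, τ, 𝒯, rfl, hg, -, -⟩ := hd
  simp only [head_cons, tail_cons]
  refine ⟨G, E, ∅, g, e, .nil, s, (1 + ε / 3) * c, rfl, hg, he, isSetCode_nil,
    Finset.empty_subset _, hs, fun p hp => ⟨(hI.pieces p hp).1, (hI.pieces p hp).2,
      Finset.disjoint_empty_left _, by simp [FinGraph.NonAdj]⟩, hI.pairwise,
    fun U u s' hu hU hs' hUE => ?_⟩
  refine ⟨G, D, U, g, x, u, s', (1 + ε / 3) * c, ℓ + 1, rfl, hβ, hg, hx, hu, hU, hs',
    fun X hX => ?_, hI.cuts_pairwise, fun V v t hV ht hVD => ?_⟩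
  · obtain ⟨h₁, h₂, -, h₄⟩ := hI.cuts X hX
    refine ⟨h₁, h₂, Finset.disjoint_left.2 fun v hvX hvU => ?_⟩
    obtain ⟨p, hp, hvp⟩ := ((hUE v).1 hvU).resolve_left (Finset.notMem_empty v)
    exact Finset.disjoint_left.1 (h₄ p hp) hvX hvp
  · have hVG : V = G.verts := by
      refine hV.antisymm fun v hv => (hVD v).2 ?_
      rcases hI.cover hT hv with hX | hp
      · exact .inr hX
      · exact .inl ((hUE v).2 (.inr hp))
    rw [hVG, FinGraph.induce_self] at ht
    -- `Z` is the union of the heavy sets, and passing to an induced subgraph does not increase the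
    -- optimum; this bounds the number of separators by `OPT(G)`.
    obtain ⟨Z, -, -, -, hZ⟩ := hI.heavy
    exact hP.isApproxSolution_iff.2
      (hP.nearOpt_of_cuts hε hε1 hc ht (hZ.trans (hP.optR_induce_le G Z)))

end GraphProblem.IsFriendly

end ApproxTuring

theorem mainTheorem1 (P : ApproxTuring.GraphProblem) (f : ℕ → ℝ) (h : ℝ → ℕ → ℕ)
    (φ : ℝ → ℕ → ℝ) (hP : P.IsFriendly f h φ) (ε : ℝ) (hε : 0 < ε) (hε1 : ε ≤ 1) :
    P.HasApproxTuringKernel (1 + ε)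
      (fun ℓ => h (ε / 3) (⌊φ (6 * f (ℓ + 1) / ε + f 1) ℓ⌋₊ + ℓ)) :=
  hP.hasApproxTuringKernel hε hε1
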